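/- Let $X$ be a real normed space with dual $X^*$, and let $F\subseteq X^*$ be a linear subspace that is norming, i.e. $x\mapsto\sup\{|f(x)| : f\in F,\ \|f\|\le 1\}$ is a norm on $X$ equivalent to the original one. Let $\sigma(X,F)$ be the weakest topology on $X$ that makes every $f\in F$ continuous. For a topology $\tau$ on $X$, a norm $\|\cdot\|$ on $X$ is called $\tau$-LUR if, for all $x\in X$ and all sequences $(x_n)$ in $X$, $\lim_n\big(2\|x\|^2+2\|x_n\|^2-\|x+x_n\|^2\big)=0$ implies $x_n\to x$ in $\tau$. A topological space $S$ is a Moore space if it is regular (and Hausdorff) and has a development, i.e. a sequence $(\mathcal G_n)_{n\in\mathbb N}$ of open covers of $S$ such that for each $x\in S$ the sets $\mathrm{st}(x,\mathcal G_n)=\bigcup\{U\in\mathcal G_n : x\in U\}$, $n\in\mathbb N$, form a neighbourhood base at $x$. A subset $S\subseteq X$ with the topology inherited from $\sigma(X,F)$ is a Moore space with $\sigma(X,F)$-slices if it is regular (and Hausdorff) and has a development all of whose members are of the form $S\cap\{x : f(x)>a\}$ with $0\ne f\in F$ and $a\in\mathbb R$. The following are equivalent: 1. $X$ admits an equivalent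 $\sigma(X,F)$-lower semicontinuous norm that is $\sigma(X,F)$-LUR; 2. $X$ admits an equivalent $\sigma(X,F)$-lower semicontinuous norm whose unit sphere, with the topology inherited from $\sigma(X,F)$, is a Moore space with $\sigma(X,F)$-slices. If $X=Y^*$ is the dual of a real normed space $Y$ and $F=Y$ (canonically embedded in $Y^{**}$), then 1 is also equivalent to: 3. $Y^*$ admits an equivalent norm that is the dual norm of an equivalent norm on $Y$ and whose unit sphere is a Moore space in the topology inherited from the weak$^*$ topology. -/

import Mathlib

open Filter Topology Set

namespace MooreRenorming

/-! ### Equivalent norms, the topology `σ(X, F)`, norming subspaces -/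

section Norms

variable {X : Type*} [NormedAddCommGroup X] [NormedSpace ℝ X]

/-- `p` is a norm on `X` that is equivalent to the given norm of `X`. (The lower bound makes the
seminorm `p` a norm.) -/
def IsEquivalentNorm (p : Seminorm ℝ X) : Prop :=
  ∃ c C : ℝ, 0 < c ∧ 0 < C ∧ ∀ x : X, c * ‖x‖ ≤ p x ∧ p x ≤ C * ‖x‖

/-- The topology `σ(X, F)` on `X` of pointwise convergence on the set `F` of functionals, i.e. the
weakest topology on `X` that makes every member of `F` continuous. -/
abbrev sigma (F : Set (StrongDual ℝ X)) : TopologicalSpace X :=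
  ⨅ f ∈ F, TopologicalSpace.induced (fun x : X => f x) inferInstance

/-- The subspace `F` of `X*` is norming: `x ↦ sup {|f x| : f ∈ F, ‖f‖ ≤ 1}` is a norm on `X`,
equivalent to the original one. -/
def IsNorming (F : Submodule ℝ (StrongDual ℝ X)) : Prop :=
  ∃ p : Seminorm ℝ X, IsEquivalentNorm p ∧
    ∀ x : X, IsLUB {r : ℝ | ∃ f ∈ F, ‖f‖ ≤ 1 ∧ r = |f x|} (p x)

/-- `p` is lower semicontinuous for the topology `τ`. -/
def IsLsc (τ : TopologicalSpace X) (p : Seminorm ℝ X) : Prop :=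
  @LowerSemicontinuous X ℝ τ _ (fun x => p x)

/-- `p` is `τ`-locally uniformly rotund. -/
def IsLUR (τ : TopologicalSpace X) (p : Seminorm ℝ X) : Prop :=
  ∀ (x : X) (u : ℕ → X),
    Tendsto (fun n => 2 * p x ^ 2 + 2 * p (u n) ^ 2 - p (x + u n) ^ 2) atTop (𝓝 0) →
      Tendsto u atTop (@nhds X τ x)

/-- The unit sphere of `p`. -/
def unitSphere (p : Seminorm ℝ X) : Set X := {x | p x = 1}

/-- `H` is a `σ(X, F)`-open half-space `{x | a < f x}`, with `f ∈ F` nonzero. -/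
def IsOpenHalfSpace (F : Set (StrongDual ℝ X)) (H : Set X) : Prop :=
  ∃ f ∈ F, f ≠ 0 ∧ ∃ a : ℝ, H = {x | a < f x}

/-- `U` is a `σ(X, F)`-open slice of the set `S`: the trace on `S` of a `σ(X, F)`-open
half-space. -/
def IsSlice (F : Set (StrongDual ℝ X)) (S : Set X) (U : Set S) : Prop :=
  ∃ H : Set X, IsOpenHalfSpace F H ∧ U = Subtype.val ⁻¹' H

end Norms

/-! ### Moore spaces -/

section Moore

/-- The star of the point `x` with respect to the family `G`. -/
def starOf {S : Type*} (x : S) (G : Set (Set S)) : Set S := ⋃₀ {U | U ∈ G ∧ x ∈ U}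

/-- `G` is a development of the topological space `S`: a sequence of open covers such that for
every `x` the stars of `x` form a neighbourhood base at `x`. -/
def IsDevelopment (S : Type*) [TopologicalSpace S] (G : ℕ → Set (Set S)) : Prop :=
  (∀ n, (∀ U ∈ G n, IsOpen U) ∧ ⋃₀ G n = univ) ∧
    ∀ x : S, (𝓝 x).HasBasis (fun _ : ℕ => True) (fun n => starOf x (G n))

/-- A Moore space: a regular (and Hausdorff) space that admits a development. -/
def IsMoore (S : Type*) [TopologicalSpace S] : Prop :=
  T3Space S ∧ ∃ G : ℕ → Set (Set S), IsDevelopment S G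

end Moore

section Spheres

variable {X : Type*} [NormedAddCommGroup X] [NormedSpace ℝ X]

/-- The subset `S` of `X` is a Moore space for the topology inherited from `τ`. -/
def IsMooreSubset (τ : TopologicalSpace X) (S : Set X) : Prop :=
  @IsMoore S (@instTopologicalSpaceSubtype X (fun x => x ∈ S) τ)

/-- The subset `S` of `X`, with the topology inherited from `σ(X, F)`, is a Moore space with
`σ(X, F)`-slices: it is regular and has a development whose members are all
`σ(X, F)`-open slices of `S`. -/
def IsMooreSubsetWithSlices (F : Set (StrongDual ℝ X)) (S : Set X) : Prop :=
  letI : TopologicalSpace S := @instTopologicalSpaceSubtype X (fun x => x ∈ S) (sigma F)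
  T3Space S ∧ ∃ G : ℕ → Set (Set S), IsDevelopment S G ∧ ∀ n, ∀ U ∈ G n, IsSlice F S U

end Spheres

/-! ### Dual spaces -/

section Dual

variable (Y : Type*) [NormedAddCommGroup Y] [NormedSpace ℝ Y]

/-- `Y` as a subspace of `Y**`, through the canonical embedding. -/
noncomputable def canonicalImage : Submodule ℝ (StrongDual ℝ (StrongDual ℝ Y)) :=
  LinearMap.range (NormedSpace.inclusionInDoubleDual ℝ Y).toLinearMap

/-- The weak* topology on `Y*`. -/
noncomputable abbrev weakStar : TopologicalSpace (StrongDual ℝ Y) :=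
  TopologicalSpace.induced (fun f : StrongDual ℝ Y => StrongDual.toWeakDual f)
    (inferInstance : TopologicalSpace (WeakDual ℝ Y))

variable {Y}

/-- The norm `p` on `Y*` is the dual norm of some equivalent norm `q` on `Y`. -/
def IsDualNorm (p : Seminorm ℝ (StrongDual ℝ Y)) : Prop :=
  ∃ q : Seminorm ℝ Y, IsEquivalentNorm q ∧
    ∀ f : StrongDual ℝ Y, IsLUB {r : ℝ | ∃ y : Y, q y ≤ 1 ∧ r = |f y|} (p f)

end Dual

end MooreRenorming

/-! From 1 to 2 (`isMooreSubsetWithSlices_of_isLUR`): the slices `{f > 1 - 1/(n+1)}` of the sphere,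
with `f ∈ F` dominated by `p`, cover it because `p` is the supremum of such functionals. If `x` and
`y` share such a slice, then `p (x + y) > 2 - 2/(n+1)`, so rotundity makes the stars of `x` shrink
to `x`.

From 2 to 1, the engine is `exists_slice_localizing_norm`. A family of half-spaces `{f > a}` with
data bounded by `M` has the sublinear potential `sup (M p, f + (M - a) p)`, which on the sphere of
`p` is `M` plus the positive part of the largest excess `f - a`. A weighted square sum of countably
many potentials is an equivalent norm `q`. If its rotundity defect along `x`, `u n` tends to `0`,
every potential becomes asymptotically affine between `x` and `u n`. A half-space that nearly
attains the potential at `x + u n` must then contain both `x` and the normalized `u n`. For the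
slices of a development this puts `u n / p (u n)` in every star of `x`, which gives convergence.

From 3 to 1 the members of the development are only open, but the ball is weak* compact. For each
cover, slices of the ball that lie, with a uniform norm margin, in one member of the cover are
removed, and the process is iterated. Every point of the sphere disappears after finitely many steps
(`exists_notMem_iterate_sliceDerivation`): otherwise either an extreme point of the intersection
lies in a small open set, and Choquet's lemma with compactness removes it, or the point is a
barycenter of a probability measure on a compact set where `p < 1`, contradicting `p x = 1`. The
localizing norm is then applied to the removed slices and also to the half-spaces disjoint from the
derived sets; the latter force `u n` close to the derived set containing `x`
(`exists_mem_seminorm_sub_le`), hence into the same small slice up to the margin.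

From 1 to 3, the slice development is in particular a development, and lower semicontinuous
equivalent norms on a dual are dual norms by separation. -/

namespace MooreRenorming

/-! ### The topology `σ(X, F)`: its dual is `F`, and separation by functionals in `F`. -/

section Sigma

variable {X : Type*} [NormedAddCommGroup X] [NormedSpace ℝ X]

lemma continuous_sigma {F : Set (StrongDual ℝ X)} {f : StrongDual ℝ X} (hf : f ∈ F) :
    @Continuous X ℝ (sigma F) _ f :=
  continuous_iInf_dom (i := f) (continuous_iInf_dom (i := hf) continuous_induced_dom)

lemma tendsto_sigma_iff {F : Set (StrongDual ℝ X)} {ι : Type*} {l : Filter ι} {u : ι → X} {x : X} :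
    Tendsto u l (@nhds X (sigma F) x) ↔ ∀ f ∈ F, Tendsto (fun n => f (u n)) l (𝓝 (f x)) := by
  simp only [nhds_iInf, nhds_induced, tendsto_iInf, tendsto_comap_iff, Function.comp_def]

lemma norm_le_sigma (F : Set (StrongDual ℝ X)) :
    (inferInstance : TopologicalSpace X) ≤ sigma F :=
  le_iInf₂ fun f _ => continuous_iff_le_induced.1 f.continuous

lemma isTopologicalAddGroup_sigma (F : Set (StrongDual ℝ X)) :
    @IsTopologicalAddGroup X (sigma F) _ :=
  topologicalAddGroup_iInf fun f => topologicalAddGroup_iInf fun _ => topologicalAddGroup_induced f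

lemma continuousSMul_sigma (F : Set (StrongDual ℝ X)) : @ContinuousSMul ℝ X _ _ (sigma F) :=
  continuousSMul_iInf fun f => continuousSMul_iInf fun _ => continuousSMul_induced f

lemma locallyConvexSpace_sigma (F : Set (StrongDual ℝ X)) :
    @LocallyConvexSpace ℝ X _ _ _ _ (sigma F) :=
  LocallyConvexSpace.iInf fun f => LocallyConvexSpace.iInf fun _ =>
    LocallyConvexSpace.induced f.toLinearMap

lemma regularSpace_sigma (F : Set (StrongDual ℝ X)) : @RegularSpace X (sigma F) :=
  regularSpace_iInf fun _ => regularSpace_iInf fun _ => regularSpace_induced _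

/-- A linear functional that is continuous for `σ(X, F)` belongs to `F`. -/
lemma exists_mem_eq_of_continuous_sigma (F : Submodule ℝ (StrongDual ℝ X)) (φ : X →ₗ[ℝ] ℝ)
    (hφ : @Continuous X ℝ (sigma (F : Set (StrongDual ℝ X))) _ φ) :
    ∃ f ∈ F, ∀ x, f x = φ x := by
  have h := (LinearMap.mem_span_iff_continuous (𝕜 := ℝ)
    (f := fun f : F => (f : StrongDual ℝ X).toLinearMap) φ).2 (by
      convert hφ using 1
      rw [iInf_subtype]; rfl)
  have : ∀ ψ ∈ Submodule.span ℝ (range fun f : F => (f : StrongDual ℝ X).toLinearMap),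
      ∃ f ∈ F, ∀ x, f x = ψ x := by
    intro ψ hψ
    induction hψ using Submodule.span_induction with
    | mem ψ h => obtain ⟨f, rfl⟩ := h; exact ⟨f, f.2, fun x => rfl⟩
    | zero => exact ⟨0, F.zero_mem, fun x => rfl⟩
    | add a b _ _ ha hb =>
      obtain ⟨f, hf, hf'⟩ := ha
      obtain ⟨g, hg, hg'⟩ := hb
      exact ⟨f + g, F.add_mem hf hg, fun x => by simp [hf', hg']⟩
    | smul c a _ ha =>
      obtain ⟨f, hf, hf'⟩ := ha
      exact ⟨c • f, F.smul_mem c hf, fun x => by simp [hf']⟩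
  exact this φ h

/-- Strict separation of a point from a `σ(X, F)`-closed convex set by a functional in `F`. -/
lemma exists_sep_of_isClosed_sigma (F : Submodule ℝ (StrongDual ℝ X)) {C : Set X}
    (hC : Convex ℝ C) (hcl : IsClosed[sigma (F : Set (StrongDual ℝ X))] C) {x : X} (hx : x ∉ C) :
    ∃ f ∈ F, ∃ a : ℝ, (∀ y ∈ C, f y < a) ∧ a < f x := by
  have h₁ := isTopologicalAddGroup_sigma (F : Set (StrongDual ℝ X))
  have h₂ := continuousSMul_sigma (F : Set (StrongDual ℝ X))
  have h₃ := locallyConvexSpace_sigma (F : Set (StrongDual ℝ X))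
  let _ : TopologicalSpace X := sigma (F : Set (StrongDual ℝ X))
  obtain ⟨φ, a, h1, h2⟩ := geometric_hahn_banach_closed_point hC hcl hx
  obtain ⟨f, hf, hfφ⟩ := exists_mem_eq_of_continuous_sigma F φ.toLinearMap φ.continuous
  refine ⟨f, hf, a, fun y hy => ?_, ?_⟩
  · rw [hfφ]; exact h1 y hy
  · rw [hfφ]; exact h2

lemma IsLsc.isClosed_le {τ : TopologicalSpace X} {p : Seminorm ℝ X} (hp : IsLsc τ p) (a : ℝ) :
    IsClosed[τ] {x | p x ≤ a} :=
  @LowerSemicontinuous.isClosed_preimage X τ ℝ _ _ hp a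

lemma Seminorm.convex_le (p : Seminorm ℝ X) (a : ℝ) : Convex ℝ {x | p x ≤ a} := by
  simpa using (p.convexOn).convex_le a

/-- A functional that is at most `c` on the ball of radius `r > 0` of `p` satisfies
`r |f| ≤ c p`. -/
lemma mul_abs_le_of_le_on_ball {p : Seminorm ℝ X} (hp : ∀ x, p x = 0 → x = 0)
    {f : StrongDual ℝ X} {r c : ℝ} (hr : 0 < r) (h : ∀ y, p y ≤ r → f y ≤ c) (x : X) :
    r * |f x| ≤ c * p x := by
  have key : ∀ x, r * f x ≤ c * p x := by
    intro x
    by_cases h0 : p x = 0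
    · simp [hp x h0]
    have hpx : 0 < p x := lt_of_le_of_ne (apply_nonneg p x) (Ne.symm h0)
    have := h ((r / p x) • x) (by
      rw [map_smul_eq_mul, Real.norm_of_nonneg (by positivity)]; field_simp; rfl)
    rw [map_smul, smul_eq_mul] at this
    field_simp at this
    linarith
  rcases abs_cases (f x) with ⟨h1, _⟩ | ⟨h1, _⟩
  · rw [h1]; exact key x
  · rw [h1]; simpa using key (-x)

lemma IsEquivalentNorm.eq_zero {p : Seminorm ℝ X} (hp : IsEquivalentNorm p) {x : X}
    (hx : p x = 0) : x = 0 := by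
  obtain ⟨c, C, hc, -, h⟩ := hp
  have := (h x).1
  rw [hx] at this
  have : ‖x‖ ≤ 0 := by
    by_contra! h'
    nlinarith
  exact norm_le_zero_iff.1 this

lemma IsEquivalentNorm.exists_bound {p : Seminorm ℝ X} (hp : IsEquivalentNorm p)
    (f : StrongDual ℝ X) : ∃ M : ℝ, 0 ≤ M ∧ ∀ x, |f x| ≤ M * p x := by
  obtain ⟨c, C, hc, -, h⟩ := hp
  refine ⟨‖f‖ / c, by positivity, fun x => ?_⟩
  calc |f x| ≤ ‖f‖ * ‖x‖ := f.le_opNorm x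
    _ = ‖f‖ / c * (c * ‖x‖) := by field_simp
    _ ≤ ‖f‖ / c * p x := by gcongr; exact (h x).1

lemma IsEquivalentNorm.pos {p : Seminorm ℝ X} (hp : IsEquivalentNorm p) {x : X}
    (hx : x ≠ 0) : 0 < p x :=
  lt_of_le_of_ne (apply_nonneg p x) fun h => hx (hp.eq_zero h.symm)

/-- An equivalent `σ(X, F)`-lower semicontinuous norm is the supremum of the functionals in `F`
that it dominates. -/
lemma exists_functional_of_lt {F : Submodule ℝ (StrongDual ℝ X)} {p : Seminorm ℝ X}
    (hp : IsEquivalentNorm p) (hl : IsLsc (sigma (F : Set (StrongDual ℝ X))) p) {x : X} {a : ℝ}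
    (hx : a < p x) : ∃ f ∈ F, (∀ y, |f y| ≤ p y) ∧ a < f x := by
  rcases lt_or_ge a 0 with ha | ha
  · exact ⟨0, F.zero_mem, fun y => by simp, by simpa using ha⟩
  obtain ⟨b, hab, hbx⟩ := exists_between hx
  have hb : 0 < b := ha.trans_lt hab
  obtain ⟨f, hf, s, h1, h2⟩ := exists_sep_of_isClosed_sigma F (Seminorm.convex_le p b)
    (hl.isClosed_le b) (x := x) (by simpa using hbx)
  have hs : 0 < s := by simpa using h1 0 (by simpa using hb.le)
  -- Since `f < s` on the ball of radius `b`, the factor `b / s` makes `f` dominated by `p`, while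
  -- its value at `x` stays above `b > a`.
  refine ⟨(b / s) • f, F.smul_mem _ hf, fun y => ?_, ?_⟩
  · have := mul_abs_le_of_le_on_ball (fun x => hp.eq_zero) hb (fun y hy => (h1 y hy).le) y
    simp only [smul_apply, smul_eq_mul, abs_mul]
    rw [abs_of_pos (by positivity)]
    field_simp
    linarith
  · simp only [smul_apply, smul_eq_mul]
    calc a < b := hab
      _ = b / s * s := by field_simp
      _ < b / s * f x := by gcongr

end Sigma

/-! ### Square sums of lower semicontinuous sublinear functions. -/

lemma lowerSemicontinuous_tsum_real {κ Z : Type*} [TopologicalSpace Z] {f : κ → Z → ℝ}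
    (h0 : ∀ k x, 0 ≤ f k x) (hf : ∀ k, LowerSemicontinuous (f k))
    (hs : ∀ x, Summable fun k => f k x) : LowerSemicontinuous fun x => ∑' k, f k x := by
  intro x a ha
  obtain ⟨s, hs'⟩ := ((hs x).hasSum.eventually (lt_mem_nhds ha)).exists
  have : LowerSemicontinuous fun x => ∑ k ∈ s, f k x := lowerSemicontinuous_sum fun k _ => hf k
  filter_upwards [this x a hs'] with y hy
  exact hy.trans_le ((hs y).sum_le_tsum s fun k _ => h0 k y)

section SquareSum

variable {X : Type*} [AddCommGroup X] [Module ℝ X]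

/-- A nonnegative, positively homogeneous, subadditive and lower semicontinuous function. -/
structure IsLscSublinear [TopologicalSpace X] (Θ : X → ℝ) : Prop where
  nonneg : ∀ x, 0 ≤ Θ x
  smul : ∀ t : ℝ, 0 ≤ t → ∀ x, Θ (t • x) = t * Θ x
  add_le : ∀ x y, Θ (x + y) ≤ Θ x + Θ y
  lsc : LowerSemicontinuous Θ

lemma IsLscSublinear.sq_lsc [TopologicalSpace X] {Θ : X → ℝ} (h : IsLscSublinear Θ) :
    LowerSemicontinuous fun x => Θ x ^ 2 := by
  -- Squaring is not monotone on the whole line; its truncation at `0` is, and agrees with it on the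
  -- values of `Θ`.
  have hc : Continuous fun t : ℝ => (max t 0) ^ 2 := by fun_prop
  have hm : Monotone fun t : ℝ => (max t 0) ^ 2 := fun s t hst => by
    have : max s 0 ≤ max t 0 := max_le_max hst le_rfl
    have : 0 ≤ max s 0 := le_max_right _ _
    dsimp only
    gcongr
  have := hc.comp_lowerSemicontinuous h.lsc hm
  simpa only [Function.comp_def, max_eq_left (h.nonneg _)] using this

/-- The square sum of a reflection-invariant family of sublinear functions is a seminorm. -/
lemma exists_seminorm_sq_eq_tsum [TopologicalSpace X] {κ : Type*} (σ : κ ≃ κ) {Θ : κ → X → ℝ}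
    (hΘ : ∀ k, IsLscSublinear (Θ k)) (hneg : ∀ k x, Θ (σ k) x = Θ k (-x))
    (hs : ∀ x, Summable fun k => Θ k x ^ 2) :
    ∃ q : Seminorm ℝ X, LowerSemicontinuous q ∧ ∀ x, q x ^ 2 = ∑' k, Θ k x ^ 2 := by
  have hnn : ∀ x, 0 ≤ ∑' k, Θ k x ^ 2 := fun x => tsum_nonneg fun k => sq_nonneg _
  have hadd : ∀ x y, √(∑' k, Θ k (x + y) ^ 2) ≤ √(∑' k, Θ k x ^ 2) + √(∑' k, Θ k y ^ 2) := by
    intro x y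
    have hx : Summable fun k => Θ k x ^ (2 : ℝ) := by simpa using hs x
    have hy : Summable fun k => Θ k y ^ (2 : ℝ) := by simpa using hs y
    have h1 := Real.Lp_add_le_tsum_of_nonneg' (p := 2) one_le_two (fun k => (hΘ k).nonneg x)
      (fun k => (hΘ k).nonneg y) hx hy
    have h2 := Real.summable_Lp_add_of_nonneg (p := 2) one_le_two (fun k => (hΘ k).nonneg x)
      (fun k => (hΘ k).nonneg y) hx hy
    simp only [Real.rpow_two, ← Real.sqrt_eq_rpow] at h1 h2
    refine le_trans (Real.sqrt_le_sqrt ?_) h1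
    refine (hs (x + y)).tsum_le_tsum (fun k => ?_) h2
    have := (hΘ k).nonneg (x + y)
    have := (hΘ k).add_le x y
    gcongr
  have hsq : ∀ (t : ℝ) (x : X), ∑' k, Θ k (t • x) ^ 2 = t ^ 2 * ∑' k, Θ k x ^ 2 := by
    have hpos : ∀ (t : ℝ) (x : X), 0 ≤ t → ∑' k, Θ k (t • x) ^ 2 = t ^ 2 * ∑' k, Θ k x ^ 2 := by
      intro t x ht
      rw [← tsum_mul_left]
      exact tsum_congr fun k => by rw [(hΘ k).smul t ht]; ring
    intro t x
    rcases le_total 0 t with ht | ht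
    · exact hpos t x ht
    · have h := hpos (-t) x (by linarith)
      rw [neg_smul] at h
      -- For negative scalars the reflection of the family is absorbed by permuting the indices.
      rw [← σ.tsum_eq]
      simp only [hneg]
      rw [h]; ring
  refine ⟨Seminorm.of (fun x => √(∑' k, Θ k x ^ 2)) hadd fun t x => ?_, ?_, fun x => ?_⟩
  · rw [hsq, Real.sqrt_mul (sq_nonneg t), Real.sqrt_sq_eq_abs, Real.norm_eq_abs]
  · exact Real.continuous_sqrt.comp_lowerSemicontinuous
      (lowerSemicontinuous_tsum_real (fun k x => sq_nonneg _) (fun k => (hΘ k).sq_lsc) hs)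
      Real.sqrt_monotone
  · exact Real.sq_sqrt (hnn x)

end SquareSum

/-- The rotundity condition for a square sum passes to each of its terms. -/
lemma tendsto_of_tendsto_square_sum {κ X : Type*} [AddCommGroup X] {Θ : κ → X → ℝ} {q : X → ℝ}
    (h0 : ∀ k x, 0 ≤ Θ k x) (hadd : ∀ k x y, Θ k (x + y) ≤ Θ k x + Θ k y)
    (hs : ∀ x, Summable fun k => Θ k x ^ 2) (hq : ∀ x, q x ^ 2 = ∑' k, Θ k x ^ 2)
    {x : X} {u : ℕ → X}
    (hu : Tendsto (fun n => 2 * q x ^ 2 + 2 * q (u n) ^ 2 - q (x + u n) ^ 2) atTop (𝓝 0)) (k : κ) :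
    Tendsto (fun n => Θ k (u n)) atTop (𝓝 (Θ k x)) ∧
      Tendsto (fun n => Θ k (x + u n)) atTop (𝓝 (2 * Θ k x)) := by
  -- Each term contributes a nonnegative amount to the defect of `q`, bounded below by a square. So
  -- a vanishing total defect forces every single defect, and every difference `Θ k x - Θ k (u n)`,
  -- to vanish.
  have hterm : ∀ j y, (Θ j x - Θ j y) ^ 2 ≤ 2 * Θ j x ^ 2 + 2 * Θ j y ^ 2 - Θ j (x + y) ^ 2 := by
    intro j y
    have h1 := h0 j (x + y)
    have h2 := hadd j x y
    have : Θ j (x + y) ^ 2 ≤ (Θ j x + Θ j y) ^ 2 := by gcongr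
    linarith
  have hle : ∀ y, 2 * Θ k x ^ 2 + 2 * Θ k y ^ 2 - Θ k (x + y) ^ 2 ≤
      2 * q x ^ 2 + 2 * q y ^ 2 - q (x + y) ^ 2 := by
    intro y
    have hS := (((hs x).mul_left 2).add ((hs y).mul_left 2)).sub (hs (x + y))
    rw [hq, hq, hq, ← tsum_mul_left, ← tsum_mul_left,
      ← ((hs x).mul_left 2).tsum_add ((hs y).mul_left 2),
      ← (((hs x).mul_left 2).add ((hs y).mul_left 2)).tsum_sub (hs (x + y))]
    exact hS.le_tsum k fun j _ => (sq_nonneg _).trans (hterm j y)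
  have hk : Tendsto (fun n => 2 * Θ k x ^ 2 + 2 * Θ k (u n) ^ 2 - Θ k (x + u n) ^ 2)
      atTop (𝓝 0) :=
    squeeze_zero (fun n => (sq_nonneg _).trans (hterm k (u n))) (fun n => hle (u n)) hu
  have hdiff : Tendsto (fun n => (Θ k x - Θ k (u n)) ^ 2) atTop (𝓝 0) :=
    squeeze_zero (fun n => sq_nonneg _) (fun n => hterm k (u n)) hk
  have hfst : Tendsto (fun n => Θ k (u n)) atTop (𝓝 (Θ k x)) := by
    have h := (Real.continuous_sqrt.tendsto 0).comp hdiff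
    simp only [Function.comp_def, Real.sqrt_sq_eq_abs, Real.sqrt_zero] at h
    rw [← tendsto_sub_nhds_zero_iff, tendsto_zero_iff_abs_tendsto_zero]
    simpa [Function.comp_def, abs_sub_comm] using h
  refine ⟨hfst, ?_⟩
  have h := ((tendsto_const_nhds (x := 2 * Θ k x ^ 2)).add ((hfst.pow 2).const_mul 2)).sub hk
  have h' := (Real.continuous_sqrt.tendsto _).comp h
  convert h' using 1
  · ext n
    simp only [Function.comp_apply, sub_sub_cancel]
    rw [Real.sqrt_sq (h0 k _)]
  · rw [show 2 * Θ k x ^ 2 + 2 * Θ k x ^ 2 - 0 = (2 * Θ k x) ^ 2 by ring,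
      Real.sqrt_sq (by linarith [h0 k x])]

/-! ### One norm controlling countably many sublinear functions. -/

section Renorming

variable {X : Type*} [NormedAddCommGroup X] [NormedSpace ℝ X]

lemma continuous_neg_sigma (F : Set (StrongDual ℝ X)) :
    @Continuous X X (sigma F) (sigma F) (fun x => -x) :=
  (isTopologicalAddGroup_sigma F).toContinuousNeg.continuous_neg

/-- Countably many sublinear functions can be built into one equivalent norm whose rotundity
controls each of them. -/
lemma exists_norm_controlling {F : Set (StrongDual ℝ X)} {p : Seminorm ℝ X}
    (hp : IsEquivalentNorm p) (hl : IsLsc (sigma F) p) {ι : Type*} [Countable ι]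
    {Ψ : ι → X → ℝ} (hΨ : ∀ i, @IsLscSublinear X _ _ (sigma F) (Ψ i))
    (hb : ∀ i, ∃ L : ℝ, ∀ x, Ψ i x ≤ L * p x) :
    ∃ q : Seminorm ℝ X, IsEquivalentNorm q ∧ IsLsc (sigma F) q ∧
      ∀ (x : X) (u : ℕ → X),
        Tendsto (fun n => 2 * q x ^ 2 + 2 * q (u n) ^ 2 - q (x + u n) ^ 2) atTop (𝓝 0) →
          Tendsto (fun n => p (u n)) atTop (𝓝 (p x)) ∧
          ∀ i, Tendsto (fun n => Ψ i (u n)) atTop (𝓝 (Ψ i x)) ∧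
            Tendsto (fun n => Ψ i (x + u n)) atTop (𝓝 (2 * Ψ i x)) := by
  -- The index `none` carries `p` itself: this gives the lower bound for `q` and the convergence of
  -- `p (u n)`.
  have hΨ' : ∀ k : Option ι, @IsLscSublinear X _ _ (sigma F) (k.elim (fun x => p x) Ψ) := by
    rintro (_ | i)
    · exact @IsLscSublinear.mk X _ _ (sigma F) _ (fun x => apply_nonneg p x)
        (fun t ht x => by simp [map_smul_eq_mul, abs_of_nonneg ht])
        (fun x y => map_add_le_add p x y) hl
    · exact hΨ i
  have hb' : ∀ k : Option ι, ∃ L : ℝ, 0 < L ∧ ∀ x, k.elim (fun x => p x) Ψ x ≤ L * p x := by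
    rintro (_ | i)
    · exact ⟨1, one_pos, fun x => by simp⟩
    · obtain ⟨L, hL⟩ := hb i
      refine ⟨max L 1, by positivity, fun x => (hL x).trans ?_⟩
      have := apply_nonneg p x
      gcongr
      exact le_max_left _ _
  generalize hΦ : (fun k : Option ι => k.elim (fun x => p x) Ψ) = Φ at *
  replace hΨ' : ∀ k, @IsLscSublinear X _ _ (sigma F) (Φ k) := by rw [← hΦ]; exact hΨ'
  replace hb' : ∀ k, ∃ L : ℝ, 0 < L ∧ ∀ x, Φ k x ≤ L * p x := by rw [← hΦ]; exact hb'
  choose L hL0 hL using hb'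
  have := Encodable.ofCountable (Option ι)
  obtain ⟨ε, hε0, E, hεE, -⟩ := posSumOfEncodable (ε := 1) one_pos (Option ι)
  -- With these weights the squared terms are at most `ε k * p x ^ 2`, which is summable.
  let c : Option ι → ℝ := fun k => √(ε k) / L k
  have hc : ∀ k, 0 < c k := fun k => div_pos (Real.sqrt_pos.2 (hε0 k)) (hL0 k)
  -- The Boolean puts in both `Φ k x` and `Φ k (-x)`, so that the square sum is even although the `Φ
  -- k` need not be.
  let Θ : Option ι × Bool → X → ℝ := fun k x => c k.1 * Φ k.1 (if k.2 then x else -x)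
  have hΘ : ∀ k, @IsLscSublinear X _ _ (sigma F) (Θ k) := by
    rintro ⟨k, b⟩
    have h := hΨ' k
    have hn := continuous_neg_sigma F
    let _ : TopologicalSpace X := sigma F
    have hm : Monotone fun t : ℝ => c k * t := fun s t hst => by
      have := (hc k).le
      dsimp only
      gcongr
    have hm' : Continuous fun t : ℝ => c k * t := by fun_prop
    cases b
    · refine ⟨fun x => mul_nonneg (hc k).le (h.nonneg _), fun t ht x => ?_, fun x y => ?_, ?_⟩
      · simp only [Θ, Bool.false_eq_true, if_false]
        rw [← smul_neg, h.smul t ht]; ring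
      · simp only [Θ, Bool.false_eq_true, if_false]
        rw [neg_add, ← mul_add]
        exact mul_le_mul_of_nonneg_left (h.add_le _ _) (hc k).le
      · exact hm'.comp_lowerSemicontinuous (fun x a ha => (hn.tendsto x).eventually (h.lsc (-x) a ha)) hm
    · refine ⟨fun x => mul_nonneg (hc k).le (h.nonneg _), fun t ht x => ?_, fun x y => ?_, ?_⟩
      · simp only [Θ, if_true]
        rw [h.smul t ht]; ring
      · simp only [Θ, if_true]
        rw [← mul_add]
        exact mul_le_mul_of_nonneg_left (h.add_le _ _) (hc k).le
      · exact hm'.comp_lowerSemicontinuous h.lsc hm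
  have hΘ0 : ∀ k x, 0 ≤ Θ k x := fun k x => @IsLscSublinear.nonneg X _ _ (sigma F) _ (hΘ k) x
  have hΘle : ∀ k x, Θ k x ^ 2 ≤ ε k.1 * p x ^ 2 := by
    rintro ⟨k, b⟩ x
    have h1 : Θ (k, b) x ≤ √(ε k) * p x := by
      have h2 : Φ k (if b then x else -x) ≤ L k * p x := by
        cases b
        · simpa using hL k (-x)
        · simpa using hL k x
      calc Θ (k, b) x ≤ c k * (L k * p x) := mul_le_mul_of_nonneg_left h2 (hc k).le
        _ = √(ε k) * p x := by simp only [c]; field_simp [(hL0 k).ne']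
    calc Θ (k, b) x ^ 2 ≤ (√(ε k) * p x) ^ 2 := by
          have := hΘ0 (k, b) x
          gcongr
      _ = ε k * p x ^ 2 := by rw [mul_pow, Real.sq_sqrt (hε0 k).le]
  have hεs : Summable fun k : Option ι × Bool => ε k.1 := by
    simpa using hεE.summable.mul_of_nonneg (Summable.of_finite (f := fun _ : Bool => (1 : ℝ)))
      (fun k => (hε0 k).le) (fun _ => zero_le_one)
  have hs : ∀ x, Summable fun k => Θ k x ^ 2 := fun x =>
    Summable.of_nonneg_of_le (fun k => sq_nonneg _) (fun k => hΘle k x) (hεs.mul_right _)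
  obtain ⟨q, hql, hq⟩ := @exists_seminorm_sq_eq_tsum X _ _ (sigma F) _
    (Equiv.prodCongr (Equiv.refl _) Equiv.boolNot) Θ hΘ
    (by rintro ⟨k, b⟩ x; cases b <;> simp [Θ]) hs
  have hΘn : ∀ x, Θ (none, true) x = c none * p x := fun x => by simp [Θ, ← hΦ]
  refine ⟨q, ?_, hql, fun x u hu => ?_⟩
  · obtain ⟨a, A, ha, hA, hpa⟩ := hp
    have hE : 0 ≤ ∑' k : Option ι × Bool, ε k.1 := tsum_nonneg fun k => (hε0 _).le
    refine ⟨c none * a, (√(∑' k : Option ι × Bool, ε k.1) + 1) * A, mul_pos (hc _) ha,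
      by positivity, fun x => ⟨?_, ?_⟩⟩
    · refine le_trans (b := c none * p x) ?_ ?_
      · rw [mul_assoc]; exact mul_le_mul_of_nonneg_left (hpa x).1 (hc _).le
      · refine le_of_sq_le_sq ?_ (apply_nonneg q x)
        rw [hq, ← hΘn]
        exact (hs x).le_tsum (none, true) fun j _ => sq_nonneg _
    · refine le_trans (b := √(∑' k : Option ι × Bool, ε k.1) * p x) ?_ ?_
      · refine le_of_sq_le_sq ?_ (mul_nonneg (Real.sqrt_nonneg _) (apply_nonneg p x))
        rw [hq, mul_pow, Real.sq_sqrt hE, ← tsum_mul_right]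
        exact (hs x).tsum_le_tsum (fun k => hΘle k x) (hεs.mul_right _)
      · rw [mul_assoc]
        exact mul_le_mul (by linarith) (hpa x).2 (apply_nonneg p x) (by positivity)
  · have key := tendsto_of_tendsto_square_sum hΘ0
      (fun k => @IsLscSublinear.add_le X _ _ (sigma F) _ (hΘ k)) hs hq hu
    have hlim : ∀ k, Tendsto (fun n => Φ k (u n)) atTop (𝓝 (Φ k x)) ∧
        Tendsto (fun n => Φ k (x + u n)) atTop (𝓝 (2 * Φ k x)) := by
      intro k
      obtain ⟨h1, h2⟩ := key (k, true)
      have e : ∀ y, (c k)⁻¹ * Θ (k, true) y = Φ k y := fun y => by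
        simp only [Θ, if_true]
        rw [inv_mul_cancel_left₀ (hc k).ne']
      constructor
      · simpa only [e] using h1.const_mul (c k)⁻¹
      · have := h2.const_mul (c k)⁻¹
        rw [mul_left_comm] at this
        simpa only [e] using this
    refine ⟨?_, fun i => ?_⟩
    · have := (hlim none).1
      rw [← hΦ] at this
      exact this
    · have := hlim (some i)
      rw [← hΦ] at this
      exact this

end Renorming

/-! ### Potentials of families of half-spaces and slice localization. -/

section Slices

variable {X : Type*} [NormedAddCommGroup X] [NormedSpace ℝ X]

/-- The homogenized supremum of the excesses `f x - a` over the half-spaces `{a < f}` with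
`(f, a) ∈ H`. -/
noncomputable def slicePotential (p : Seminorm ℝ X) (M : ℝ) (H : Set (StrongDual ℝ X × ℝ)) (x : X) :
    ℝ :=
  ⨆ h : Option H, h.elim (M * p x) fun h => h.1.1 x + (M - h.1.2) * p x

/-- The half-spaces in `H` are given by functionals in `F` and their data are bounded by `M`. -/
def IsBoundedSliceFamily (F : Set (StrongDual ℝ X)) (p : Seminorm ℝ X) (M : ℝ)
    (H : Set (StrongDual ℝ X × ℝ)) : Prop :=
  ∀ h ∈ H, h.1 ∈ F ∧ (∀ x, |h.1 x| ≤ M * p x) ∧ |h.2| ≤ M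

variable {F : Set (StrongDual ℝ X)} {p : Seminorm ℝ X} {M : ℝ} {H : Set (StrongDual ℝ X × ℝ)}

lemma IsBoundedSliceFamily.value_le (hH : IsBoundedSliceFamily F p M H) (hM : 0 ≤ M) (x : X)
    (h : Option H) :
    h.elim (M * p x) (fun h => h.1.1 x + (M - h.1.2) * p x) ≤ 3 * M * p x := by
  have hx := apply_nonneg p x
  rcases h with _ | ⟨⟨f, a⟩, hf⟩
  · simp only [Option.elim_none]; nlinarith [mul_nonneg hM hx]
  · obtain ⟨-, h1, h2⟩ := hH _ hf
    have h3 := (abs_le.1 (h1 x)).2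
    have h4 := (abs_le.1 h2).1
    simp only [Option.elim_some] at *
    nlinarith

lemma IsBoundedSliceFamily.bddAbove (hH : IsBoundedSliceFamily F p M H) (hM : 0 ≤ M) (x : X) :
    BddAbove (range fun h : Option H =>
      h.elim (M * p x) fun h => h.1.1 x + (M - h.1.2) * p x) :=
  ⟨3 * M * p x, by rintro _ ⟨h, rfl⟩; exact hH.value_le hM x h⟩

lemma IsBoundedSliceFamily.le_slicePotential (hH : IsBoundedSliceFamily F p M H) (hM : 0 ≤ M)
    {f : StrongDual ℝ X} {a : ℝ} (hf : (f, a) ∈ H) (x : X) :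
    f x + (M - a) * p x ≤ slicePotential p M H x :=
  le_ciSup (hH.bddAbove hM x) (some ⟨(f, a), hf⟩)

lemma IsBoundedSliceFamily.mul_le_slicePotential (hH : IsBoundedSliceFamily F p M H) (hM : 0 ≤ M)
    (x : X) : M * p x ≤ slicePotential p M H x :=
  le_ciSup (hH.bddAbove hM x) none

lemma slicePotential_le {x : X} {b : ℝ} (h0 : M * p x ≤ b)
    (h : ∀ f a, (f, a) ∈ H → f x + (M - a) * p x ≤ b) : slicePotential p M H x ≤ b := by
  refine ciSup_le ?_
  rintro (_ | ⟨⟨f, a⟩, hf⟩)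
  · exact h0
  · exact h f a hf

lemma exists_lt_of_lt_slicePotential {x : X} {b : ℝ} (hb : b < slicePotential p M H x) :
    b < M * p x ∨ ∃ f a, (f, a) ∈ H ∧ b < f x + (M - a) * p x := by
  obtain ⟨h, hh⟩ := exists_lt_of_lt_ciSup hb
  rcases h with _ | ⟨⟨f, a⟩, hf⟩
  · exact Or.inl hh
  · exact Or.inr ⟨f, a, hf, hh⟩

/-- The bound `|a| ≤ M` makes the coefficient `M - a` nonnegative, so each competitor `f + (M - a)
p` is itself subadditive, positively homogeneous and lower semicontinuous; suprema keep these
properties. The competitor `M p` makes the potential nonnegative. -/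
lemma IsBoundedSliceFamily.isLscSublinear (hH : IsBoundedSliceFamily F p M H) (hM : 0 ≤ M)
    (hl : IsLsc (sigma F) p) : @IsLscSublinear X _ _ (sigma F) (slicePotential p M H) := by
  refine @IsLscSublinear.mk X _ _ (sigma F) _ (fun x => ?_) (fun t ht x => ?_) (fun x y => ?_) ?_
  · exact (mul_nonneg hM (apply_nonneg p x)).trans (hH.mul_le_slicePotential hM x)
  · rw [slicePotential, slicePotential, Real.mul_iSup_of_nonneg ht]
    congr 1
    ext h
    rcases h with _ | h
    · simp [map_smul_eq_mul, abs_of_nonneg ht]; ring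
    · simp [map_smul_eq_mul, abs_of_nonneg ht]; ring
  · have hpxy := map_add_le_add p x y
    refine slicePotential_le ?_ fun f a hf => ?_
    · have h1 := hH.mul_le_slicePotential hM x
      have h2 := hH.mul_le_slicePotential hM y
      nlinarith
    · have h1 := hH.le_slicePotential hM hf x
      have h2 := hH.le_slicePotential hM hf y
      have h3 : 0 ≤ M - a := sub_nonneg.2 (abs_le.1 (hH _ hf).2.2).2
      rw [map_add]
      nlinarith
  · have hmul : ∀ c : ℝ, 0 ≤ c → @LowerSemicontinuous X ℝ (sigma F) _ fun x => c * p x := by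
      intro c hc
      let _ : TopologicalSpace X := sigma F
      exact (continuous_const_mul c).comp_lowerSemicontinuous hl
        (monotone_mul_left_of_nonneg hc)
    have hc : ∀ h : H, @Continuous X ℝ (sigma F) _ h.1.1 := fun h => continuous_sigma (hH _ h.2).1
    have hbdd := hH.bddAbove hM
    let _ : TopologicalSpace X := sigma F
    refine lowerSemicontinuous_ciSup hbdd ?_
    rintro (_ | h)
    · exact hmul M hM
    · exact (hc h).lowerSemicontinuous.add
        (hmul _ (sub_nonneg.2 (abs_le.1 (hH _ h.2).2.2).2))

/-- Slice localization: countably many bounded families of half-spaces can be built into an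
equivalent norm whose rotundity puts `x` and eventually `u n`, normalized, into a common half-space
of each family that has one containing `x`, and keeps `u n` almost outside all half-spaces of each
family that has none containing `x`. -/
theorem exists_slice_localizing_norm (hp : IsEquivalentNorm p) (hl : IsLsc (sigma F) p)
    {ι : Type*} [Countable ι] {H : ι → Set (StrongDual ℝ X × ℝ)} {M : ι → ℝ} (hM : ∀ i, 0 ≤ M i)
    (hH : ∀ i, IsBoundedSliceFamily F p (M i) (H i)) :
    ∃ q : Seminorm ℝ X, IsEquivalentNorm q ∧ IsLsc (sigma F) q ∧
      ∀ (x : X) (u : ℕ → X), p x = 1 →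
        Tendsto (fun n => 2 * q x ^ 2 + 2 * q (u n) ^ 2 - q (x + u n) ^ 2) atTop (𝓝 0) →
          Tendsto (fun n => p (u n)) atTop (𝓝 1) ∧
          ∀ i, ((∃ f a, (f, a) ∈ H i ∧ a < f x) → ∃ η > 0, ∀ᶠ n in atTop, ∃ f a, (f, a) ∈ H i ∧
              a < f x ∧ (a + η) * p (u n) < f (u n)) ∧
            ((∀ f a, (f, a) ∈ H i → f x ≤ a) → ∀ δ > 0, ∀ᶠ n in atTop, ∀ f a, (f, a) ∈ H i →
              f (u n) ≤ (a + δ) * p (u n)) := by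
  obtain ⟨q, hq, hql, hlim⟩ := exists_norm_controlling hp hl
    (fun i => (hH i).isLscSublinear (hM i) hl)
    (fun i => ⟨3 * M i, fun x => ciSup_le ((hH i).value_le (hM i) x)⟩)
  refine ⟨q, hq, hql, fun x u hx hu => ?_⟩
  obtain ⟨hpu, hΨ⟩ := hlim x u hu
  rw [hx] at hpu
  refine ⟨hpu, fun i => ⟨?_, ?_⟩⟩
  · rintro ⟨f₀, a₀, hf₀, ha₀⟩
    obtain ⟨h1, h2⟩ := hΨ i
    have hs : M i < slicePotential p (M i) (H i) x := by
      have := (hH i).le_slicePotential (hM i) hf₀ x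
      rw [hx] at this
      linarith
    set s := slicePotential p (M i) (H i) x
    -- The gap `s - M i = 8ε` is positive because some half-space contains `x`; the approximation
    -- errors below cost at most `2ε` of it, and `p (u n) < 2` turns what is left into the margin
    -- `ε`.
    obtain ⟨ε, hε⟩ : ∃ ε, ε = (s - M i) / 8 := ⟨_, rfl⟩
    have hε0 : 0 < ε := by linarith
    refine ⟨ε, hε0, ?_⟩
    have hMu : Tendsto (fun n => M i * p (u n)) atTop (𝓝 (M i)) := by
      simpa using hpu.const_mul (M i)
    filter_upwards [h1.eventually (gt_mem_nhds (show s < s + ε by linarith)),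
      h2.eventually (lt_mem_nhds (show 2 * s - ε < 2 * s by linarith)),
      hMu.eventually (gt_mem_nhds (show M i < M i + ε by linarith)),
      hpu.eventually (gt_mem_nhds one_lt_two)] with n e1 e2 e3 e4
    have hpxy := map_add_le_add p x (u n)
    -- The competitor `M p` is too small to be nearly optimal at `x + u n`. For a nearly optimal
    -- `(f, a)`, splitting its value over `x` and `u n` and bounding one part by the potential
    -- leaves the other part above `M`.
    rcases exists_lt_of_lt_slicePotential e2 with h | ⟨f, a, hf, h⟩
    · have := mul_le_mul_of_nonneg_left hpxy (hM i)
      rw [hx] at this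
      linarith
    · have v1 := (hH i).le_slicePotential (hM i) hf x
      have v2 := (hH i).le_slicePotential (hM i) hf (u n)
      have h3 : 0 ≤ M i - a := sub_nonneg.2 (abs_le.1 (hH i _ hf).2.2).2
      have h4 := mul_le_mul_of_nonneg_left hpxy h3
      rw [map_add] at h
      rw [hx] at h4 v1
      refine ⟨f, a, hf, by linarith, by nlinarith⟩
  · intro hout δ hδ
    -- With no excess at `x` the potential is at its floor, so by convergence no half-space can have
    -- a definite excess at `u n`.
    have hs : slicePotential p (M i) (H i) x ≤ M i :=
      slicePotential_le (by rw [hx, mul_one]) fun f a hf => by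
        have := hout f a hf
        rw [hx]; linarith
    have h1 := (hΨ i).1
    have hMu : Tendsto (fun n => M i * p (u n)) atTop (𝓝 (M i)) := by
      simpa using hpu.const_mul (M i)
    filter_upwards [h1.eventually (gt_mem_nhds (show _ < M i + δ / 8 by linarith)),
      hMu.eventually (lt_mem_nhds (show M i - δ / 8 < M i by linarith)),
      hpu.eventually (lt_mem_nhds one_half_lt_one)] with n e1 e2 e3 f a hf
    have v := (hH i).le_slicePotential (hM i) hf (u n)
    nlinarith

/-- A norm is locally uniformly rotund as soon as it is so at the points of the unit sphere of
another equivalent norm. -/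
lemma isLUR_of_unitSphere {q : Seminorm ℝ X} (hp : IsEquivalentNorm p) (hq : IsEquivalentNorm q)
    (h : ∀ (x : X) (u : ℕ → X), p x = 1 →
      Tendsto (fun n => 2 * q x ^ 2 + 2 * q (u n) ^ 2 - q (x + u n) ^ 2) atTop (𝓝 0) →
        ∀ f ∈ F, Tendsto (fun n => f (u n)) atTop (𝓝 (f x))) :
    IsLUR (sigma F) q := by
  intro x u hu
  rw [tendsto_sigma_iff]
  rcases eq_or_ne x 0 with rfl | hx
  · have hq0 : Tendsto (fun n => q (u n)) atTop (𝓝 0) := by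
      have h1 : Tendsto (fun n => q (u n) ^ 2) atTop (𝓝 0) := by
        refine hu.congr fun n => ?_
        rw [map_zero, zero_add]; ring
      have h2 := (Real.continuous_sqrt.tendsto 0).comp h1
      simpa [Function.comp_def, Real.sqrt_sq (apply_nonneg q _)] using h2
    intro f _
    obtain ⟨K, -, hK⟩ := hq.exists_bound f
    rw [map_zero]
    exact squeeze_zero_norm (fun n => hK (u n)) (by simpa using hq0.const_mul K)
  · have ht : 0 < p x := hp.pos hx
    set t := p x
    have hsm : ∀ y, q (t⁻¹ • y) = t⁻¹ * q y := fun y => by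
      rw [map_smul_eq_mul, Real.norm_of_nonneg (inv_nonneg.2 ht.le)]
    -- The defect is homogeneous of degree two, so `x` and the sequence may be rescaled together.
    have h1 := h (t⁻¹ • x) (fun n => t⁻¹ • u n)
      (by rw [map_smul_eq_mul, Real.norm_of_nonneg (inv_nonneg.2 ht.le), inv_mul_cancel₀ ht.ne'])
      (by
        have := hu.const_mul (t⁻¹ ^ 2)
        rw [mul_zero] at this
        refine this.congr fun n => ?_
        rw [← smul_add, hsm, hsm, hsm]; ring)
    intro f hf
    have h2 := (h1 f hf).const_mul t
    simpa [mul_inv_cancel_left₀ ht.ne'] using h2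

/-- If the rotundity of `q` puts the normalized points of a sequence eventually into each star of a
development of the unit sphere of `p`, then `q` is locally uniformly rotund. -/
lemma isLUR_of_mem_starOf {q : Seminorm ℝ X} (hp : IsEquivalentNorm p) (hq : IsEquivalentNorm q)
    {G : ℕ → Set (Set (unitSphere p))}
    (hG : @IsDevelopment (unitSphere p)
      (@instTopologicalSpaceSubtype X (fun x => x ∈ unitSphere p) (sigma F)) G)
    (h : ∀ (x : X) (u : ℕ → X) (hx : p x = 1),
      Tendsto (fun n => 2 * q x ^ 2 + 2 * q (u n) ^ 2 - q (x + u n) ^ 2) atTop (𝓝 0) →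
        Tendsto (fun n => p (u n)) atTop (𝓝 1) ∧
        ∀ n, ∀ᶠ j in atTop, ∀ hv : p ((p (u j))⁻¹ • u j) = 1,
          (⟨_, hv⟩ : unitSphere p) ∈ starOf (⟨x, hx⟩ : unitSphere p) (G n)) :
    IsLUR (sigma F) q := by
  refine isLUR_of_unitSphere hp hq fun x u hx hu f hf => ?_
  obtain ⟨hpu, hst⟩ := h x u hx hu
  have hpos : ∀ᶠ j in atTop, 0 < p (u j) := hpu.eventually (lt_mem_nhds one_pos)
  have hv : Tendsto (fun j => f ((p (u j))⁻¹ • u j)) atTop (𝓝 (f x)) := by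
    rw [tendsto_def]
    intro V hV
    let _ : TopologicalSpace X := sigma F
    have hc : Continuous fun z : unitSphere p => f z :=
      (continuous_sigma hf).comp continuous_subtype_val
    obtain ⟨n, -, hn⟩ := (hG.2 ⟨x, hx⟩).mem_iff.1 (hc.continuousAt.preimage_mem_nhds hV)
    filter_upwards [hst n, hpos] with j h1 h2
    have h3 : p ((p (u j))⁻¹ • u j) = 1 := by
      rw [map_smul_eq_mul, Real.norm_of_nonneg (inv_nonneg.2 h2.le), inv_mul_cancel₀ h2.ne']
    exact hn (h1 h3)
  have := hpu.mul hv
  rw [one_mul] at this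
  refine this.congr' ?_
  filter_upwards [hpos] with j hj
  rw [map_smul, smul_eq_mul, mul_inv_cancel_left₀ hj.ne']

end Slices

/-! ### Equivalence of rotund norms and spheres that are Moore spaces with slices. -/

section SliceCharacterization

variable {X : Type*} [NormedAddCommGroup X] [NormedSpace ℝ X]
  {F : Submodule ℝ (StrongDual ℝ X)} {p : Seminorm ℝ X}

/-- Regularity is automatic for an initial topology of real functions; for the Hausdorff property,
`F` separates points because `p (x - y) > 0` is approximated by functionals in `F`. -/
lemma t3Space_sigma_subtype (hp : IsEquivalentNorm p)
    (hl : IsLsc (sigma (F : Set (StrongDual ℝ X))) p) (S : Set X) :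
    @T3Space S (@instTopologicalSpaceSubtype X (fun x => x ∈ S)
      (sigma (F : Set (StrongDual ℝ X)))) := by
  have hreg := regularSpace_sigma (F : Set (StrongDual ℝ X))
  have hc : ∀ f ∈ F, @Continuous X ℝ (sigma (F : Set (StrongDual ℝ X))) _ f := fun f hf =>
    continuous_sigma hf
  have hex : ∀ x y : X, x ≠ y → ∃ f ∈ F, f x ≠ f y := fun x y hxy => by
    obtain ⟨f, hf, -, h⟩ := exists_functional_of_lt hp hl (hp.pos (sub_ne_zero.2 hxy))
    exact ⟨f, hf, fun h' => by rw [map_sub, h', sub_self] at h; exact lt_irrefl _ h⟩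
  let _ : TopologicalSpace X := sigma (F : Set (StrongDual ℝ X))
  have : T0Space X := ⟨fun x y hxy => by
    by_contra hne
    obtain ⟨f, hf, h⟩ := hex x y hne
    exact h ((hxy.map (hc f hf)).eq)⟩
  have : T3Space X := {}
  infer_instance

/-- The unit sphere of a `σ(X, F)`-lower semicontinuous, `σ(X, F)`-LUR norm is a Moore space with
`σ(X, F)`-slices. -/
theorem isMooreSubsetWithSlices_of_isLUR (hp : IsEquivalentNorm p)
    (hl : IsLsc (sigma (F : Set (StrongDual ℝ X))) p)
    (hr : IsLUR (sigma (F : Set (StrongDual ℝ X))) p) :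
    IsMooreSubsetWithSlices (F : Set (StrongDual ℝ X)) (unitSphere p) := by
  refine ⟨t3Space_sigma_subtype hp hl _, ?_⟩
  let G : ℕ → Set (Set (unitSphere p)) := fun n => {U | ∃ f ∈ F, f ≠ 0 ∧ (∀ y, |f y| ≤ p y) ∧
    U = Subtype.val ⁻¹' {x : X | 1 - 1 / ((n : ℝ) + 1) < f x}}
  have hopen : ∀ n, ∀ U ∈ G n, IsOpen[@instTopologicalSpaceSubtype X (fun x => x ∈ unitSphere p)
      (sigma (F : Set (StrongDual ℝ X)))] U := by
    rintro n U ⟨f, hf, -, -, rfl⟩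
    have hc := continuous_sigma (F := (F : Set (StrongDual ℝ X))) hf
    let _ : TopologicalSpace X := sigma (F : Set (StrongDual ℝ X))
    exact (isOpen_lt continuous_const hc).preimage continuous_subtype_val
  have hcov : ∀ n (x : unitSphere p), ∃ U ∈ G n, x ∈ U := by
    intro n x
    have h0 : (0 : ℝ) < 1 / ((n : ℝ) + 1) := by positivity
    have hx : 1 - 1 / ((n : ℝ) + 1) < p x := by
      rw [show p x = 1 from x.2]; linarith
    obtain ⟨f, hf, hfp, hfx⟩ := exists_functional_of_lt hp hl hx
    refine ⟨_, ⟨f, hf, ?_, hfp, rfl⟩, hfx⟩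
    rintro rfl
    have : 1 / ((n : ℝ) + 1) ≤ 1 := by
      rw [div_le_one (by positivity)]; linarith [(n.cast_nonneg : (0 : ℝ) ≤ n)]
    have h1 : 1 - 1 / ((n : ℝ) + 1) < 0 := hfx
    linarith
  refine ⟨G, ⟨fun n => ⟨hopen n, ?_⟩, fun x => ⟨fun s => ⟨fun hs => ?_, ?_⟩⟩⟩, ?_⟩
  · exact eq_univ_of_forall fun x => (hcov n x).imp fun U h => ⟨h.1, h.2⟩
  · by_contra! hns
    have hns' : ∀ n, ∃ y ∈ starOf x (G n), y ∉ s := fun n => not_subset.1 (hns n trivial)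
    choose v hv hvs using hns'
    -- The functional of a common slice is dominated by `p` and exceeds `1 - 1/(n+1)` at both
    -- points.
    have hlow : ∀ n : ℕ, 2 - 2 * (1 / ((n : ℝ) + 1)) ≤ p (x + v n) := by
      intro n
      obtain ⟨U, ⟨⟨f, hf, -, hfp, rfl⟩, hxU⟩, hvU⟩ := hv n
      have h1 : 1 - 1 / ((n : ℝ) + 1) < f x := hxU
      have h2 : 1 - 1 / ((n : ℝ) + 1) < f (v n) := hvU
      have h3 := (abs_le.1 (hfp (x + v n))).2
      rw [map_add] at h3
      linarith
    have hlim : Tendsto (fun n => 2 * p x ^ 2 + 2 * p (v n) ^ 2 - p (x + v n) ^ 2)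
        atTop (𝓝 0) := by
      have h0 : Tendsto (fun n : ℕ => 4 - (2 - 2 * (1 / ((n : ℝ) + 1))) ^ 2) atTop (𝓝 0) := by
        have h := (tendsto_const_nhds (x := (2 : ℝ))).sub
          ((tendsto_one_div_add_atTop_nhds_zero_nat (𝕜 := ℝ)).const_mul 2)
        have h' := (tendsto_const_nhds (x := (4 : ℝ))).sub (h.pow 2)
        norm_num at h' ⊢
        exact h'
      refine squeeze_zero (fun n => ?_) (fun n => ?_) h0
      · have h1 := map_add_le_add p (x : X) (v n : X)
        rw [show p x = 1 from x.2, show p (v n) = 1 from (v n).2] at *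
        nlinarith [apply_nonneg p (x + v n : X)]
      · rw [show p x = 1 from x.2, show p (v n) = 1 from (v n).2]
        have h1 : 1 / ((n : ℝ) + 1) ≤ 1 := by
          rw [div_le_one (by positivity)]; linarith [(n.cast_nonneg : (0 : ℝ) ≤ n)]
        have h2 := hlow n
        have h3 : (2 - 2 * (1 / ((n : ℝ) + 1))) ^ 2 ≤ p (x + v n) ^ 2 := by
          have : 0 ≤ 2 - 2 * (1 / ((n : ℝ) + 1)) := by linarith
          gcongr
        linarith
    have hconv := hr x (fun n => v n) hlim
    let _ : TopologicalSpace X := sigma (F : Set (StrongDual ℝ X))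
    have hconv' : Tendsto v atTop (𝓝 x) := tendsto_subtype_rng.2 hconv
    obtain ⟨n, hn⟩ := (hconv'.eventually hs).exists
    exact hvs n hn
  · rintro ⟨n, -, hn⟩
    obtain ⟨U, hU, hxU⟩ := hcov n x
    let _ : TopologicalSpace X := sigma (F : Set (StrongDual ℝ X))
    exact mem_of_superset ((hopen n U hU).mem_nhds hxU)
      fun y hy => hn ⟨U, ⟨hU, hxU⟩, hy⟩
  · rintro n U ⟨f, hf, hf0, -, rfl⟩
    exact ⟨_, ⟨f, hf, hf0, _, rfl⟩, rfl⟩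

lemma seminorm_inv_smul_self {x : X} (hx : 0 < p x) : p ((p x)⁻¹ • x) = 1 := by
  rw [map_smul_eq_mul, Real.norm_of_nonneg (inv_nonneg.2 hx.le), inv_mul_cancel₀ hx.ne']

lemma IsEquivalentNorm.exists_nat_bound (hp : IsEquivalentNorm p) (f : StrongDual ℝ X) (a : ℝ) :
    ∃ m : ℕ, (∀ x, |f x| ≤ m * p x) ∧ |a| ≤ m := by
  obtain ⟨K, -, hK⟩ := hp.exists_bound f
  obtain ⟨m, hm⟩ := exists_nat_ge (max K |a|)
  refine ⟨m, fun x => (hK x).trans ?_, (le_max_right _ _).trans hm⟩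
  have := apply_nonneg p x
  gcongr
  exact (le_max_left _ _).trans hm

/-- If the unit sphere of a `σ(X, F)`-lower semicontinuous norm is a Moore space with
`σ(X, F)`-slices, then there is an equivalent `σ(X, F)`-LUR norm. -/
theorem exists_isLUR_of_isMooreSubsetWithSlices (hp : IsEquivalentNorm p)
    (hl : IsLsc (sigma (F : Set (StrongDual ℝ X))) p)
    (hS : IsMooreSubsetWithSlices (F : Set (StrongDual ℝ X)) (unitSphere p)) :
    ∃ q : Seminorm ℝ X, IsEquivalentNorm q ∧ IsLsc (sigma (F : Set (StrongDual ℝ X))) q ∧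
      IsLUR (sigma (F : Set (StrongDual ℝ X))) q := by
  obtain ⟨-, G, hG, hslice⟩ := hS
  -- Potentials need uniformly bounded data, so the half-spaces cutting out members of `G n` are
  -- sorted by an integer bound on the functional and the constant. The index set stays countable.
  let H : ℕ × ℕ → Set (StrongDual ℝ X × ℝ) := fun i => {h | h.1 ∈ F ∧
    (∀ x, |h.1 x| ≤ (i.2 : ℝ) * p x) ∧ |h.2| ≤ (i.2 : ℝ) ∧
    (Subtype.val ⁻¹' {x : X | h.2 < h.1 x} : Set (unitSphere p)) ∈ G i.1}
  obtain ⟨q, hq, hql, hloc⟩ := exists_slice_localizing_norm hp hl (H := H)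
    (M := fun i => (i.2 : ℝ)) (fun i => Nat.cast_nonneg _)
    (fun i h hh => ⟨hh.1, hh.2.1, hh.2.2.1⟩)
  refine ⟨q, hq, hql, isLUR_of_mem_starOf hp hq hG fun x u hx hu => ?_⟩
  obtain ⟨hpu, h⟩ := hloc x u hx hu
  refine ⟨hpu, fun n => ?_⟩
  have hxG : (⟨x, hx⟩ : unitSphere p) ∈ ⋃₀ G n := by rw [(hG.1 n).2]; trivial
  obtain ⟨U, hU, hxU⟩ := hxG
  obtain ⟨_, ⟨f, hf, -, a, rfl⟩, rfl⟩ := hslice n U hU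
  obtain ⟨m, hm, hm'⟩ := hp.exists_nat_bound f a
  obtain ⟨η, hη, hev⟩ := (h (n, m)).1 ⟨f, a, ⟨hf, hm, hm', hU⟩, hxU⟩
  filter_upwards [hev, hpu.eventually (lt_mem_nhds one_pos)] with j ⟨g, b, hg, hgx, hgu⟩ hpos hv
  refine ⟨_, ⟨hg.2.2.2, hgx⟩, ?_⟩
  show b < g ((p (u j))⁻¹ • u j)
  rw [map_smul, smul_eq_mul, lt_inv_mul_iff₀ hpos]
  nlinarith

end SliceCharacterization

/-! ### Choquet's lemma on slices at extreme points. -/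

section CompactConvex

variable {E : Type*} [AddCommGroup E] [Module ℝ E] [TopologicalSpace E]

lemma isCompact_convexJoin [ContinuousAdd E] [ContinuousSMul ℝ E] {A D : Set E}
    (hA : IsCompact A) (hD : IsCompact D) : IsCompact (convexJoin ℝ A D) := by
  have h : convexJoin ℝ A D =
      (fun z : (E × E) × ℝ => (1 - z.2) • z.1.1 + z.2 • z.1.2) '' ((A ×ˢ D) ×ˢ Icc (0 : ℝ) 1) := by
    ext x
    simp only [mem_convexJoin, segment_eq_image, mem_image, Prod.exists, mem_prod]
    constructor
    · rintro ⟨a, ha, d, hd, t, ht, rfl⟩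
      exact ⟨a, d, t, ⟨⟨ha, hd⟩, ht⟩, rfl⟩
    · rintro ⟨a, d, t, ⟨⟨ha, hd⟩, ht⟩, rfl⟩
      exact ⟨a, ha, d, hd, t, ht, rfl⟩
  rw [h]
  exact ((hA.prod hD).prod isCompact_Icc).image (by fun_prop)

/-- Choquet's lemma: the slices containing an extreme point of a compact convex set form a
neighbourhood base at this point. -/
lemma exists_slice_subset_of_mem_extremePoints [IsTopologicalAddGroup E] [ContinuousSMul ℝ E]
    [LocallyConvexSpace ℝ E] [T2Space E] {C : Set E} (hC : IsCompact C) (hconv : Convex ℝ C)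
    {e : E} (he : e ∈ C.extremePoints ℝ) {N : Set E} (hN : IsOpen N) (heN : e ∈ N) :
    ∃ f : StrongDual ℝ E, ∃ a : ℝ, a < f e ∧ ∀ y ∈ C, a ≤ f y → y ∈ N := by
  have hK : IsCompact (C \ N) := hC.diff hN
  obtain ⟨D, hD, hDconv, hDC, heD, hsub⟩ : ∃ D : Set E, IsCompact D ∧ Convex ℝ D ∧ D ⊆ C ∧
      e ∉ D ∧ C \ N ⊆ D := by
    -- By compactness, `C \ N` is covered by finitely many traces on `C` of half-spaces missing `e`.
    -- The convex join of two such compact convex sets still misses `e`, because an extreme point on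
    -- a segment in `C` is one of its ends.
    refine hK.induction_on (p := fun t => ∃ D : Set E, IsCompact D ∧ Convex ℝ D ∧ D ⊆ C ∧
      e ∉ D ∧ t ⊆ D) ?_ ?_ ?_ ?_
    · exact ⟨∅, isCompact_empty, convex_empty, empty_subset _, notMem_empty _, le_rfl⟩
    · rintro s t hst ⟨D, h1, h2, h3, h4, h5⟩
      exact ⟨D, h1, h2, h3, h4, hst.trans h5⟩
    · rintro s t ⟨A, hA, hAc, hAC, heA, hsA⟩ ⟨D, hD, hDc, hDC, heD, htD⟩
      rcases A.eq_empty_or_nonempty with rfl | hAn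
      · exact ⟨D, hD, hDc, hDC, heD, union_subset (hsA.trans (empty_subset _)) htD⟩
      rcases D.eq_empty_or_nonempty with rfl | hDn
      · exact ⟨A, hA, hAc, hAC, heA, union_subset hsA (htD.trans (empty_subset _))⟩
      refine ⟨convexJoin ℝ A D, isCompact_convexJoin hA hD, hAc.convexJoin hDc, ?_, ?_, ?_⟩
      · intro x hx
        obtain ⟨a, ha, d, hd, hx⟩ := mem_convexJoin.1 hx
        exact hconv.segment_subset (hAC ha) (hDC hd) hx
      · intro hx
        obtain ⟨a, ha, d, hd, hx⟩ := mem_convexJoin.1 hx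
        rcases (mem_extremePoints_iff_forall_segment.1 he).2 a (hAC ha) d (hDC hd) hx with rfl | rfl
        · exact heA ha
        · exact heD hd
      · exact union_subset (hsA.trans (subset_convexJoin_left hDn))
          (htD.trans (subset_convexJoin_right hAn))
    · rintro y ⟨hyC, hyN⟩
      obtain ⟨f, hf⟩ := geometric_hahn_banach_point_point (x := y) (y := e)
        (by rintro rfl; exact hyN heN)
      obtain ⟨a, hya, hae⟩ := exists_between hf
      refine ⟨{z | f z ≤ a} ∩ (C \ N), inter_mem (mem_nhdsWithin_of_mem_nhds ?_) self_mem_nhdsWithin,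
        C ∩ {z | f z ≤ a},
        hC.inter_right (isClosed_le f.continuous continuous_const),
        hconv.inter (convex_halfSpace_le f.toLinearMap.isLinear a), inter_subset_left,
        fun h => not_lt_of_ge h.2 hae, fun z hz => ⟨hz.2.1, hz.1⟩⟩
      exact mem_of_superset (f.continuous.continuousAt.preimage_mem_nhds (Iio_mem_nhds hya))
        fun z hz => (le_of_lt hz : f z ≤ a)
  obtain ⟨f, a, h1, h2⟩ := geometric_hahn_banach_closed_point hDconv hD.isClosed heD
  refine ⟨f, a, h2, fun y hy hay => ?_⟩
  by_contra hyN
  exact not_lt_of_ge hay (h1 y (hsub ⟨hy, hyN⟩))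

end CompactConvex

/-! ### Barycenters of probability measures on compact sets. -/

section Barycenter

open MeasureTheory CompactlySupported

variable {E : Type*} [AddCommGroup E] [Module ℝ E] [TopologicalSpace E]

/-- The restriction of a continuous linear functional to a compact set. -/
def restrictCompact (K : Set E) [CompactSpace K] (f : StrongDual ℝ E) : C_c(K, ℝ) where
  toFun k := f k
  continuous_toFun := f.continuous.comp continuous_subtype_val
  hasCompactSupport' := HasCompactSupport.of_compactSpace _

/-- `L` is a positive normalized functional on `C(K)` that represents the point `z`. -/
def Represents (K : Set E) [CompactSpace K] (L : C_c(K, ℝ) →ₗ[ℝ] ℝ) (z : E) : Prop :=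
  (∀ (g : C_c(K, ℝ)) (b : ℝ), (∀ k, g k ≤ b) → L g ≤ b) ∧
    ∀ f : StrongDual ℝ E, L (restrictCompact K f) = f z

/-- Point evaluations represent the points of `K`, and the representable points form a convex set.
-/
lemma exists_represents_of_mem_convexHull {K : Set E} [CompactSpace K] {z : E}
    (hz : z ∈ convexHull ℝ K) : ∃ L, Represents K L z := by
  have hconv : Convex ℝ {z : E | ∃ L, Represents K L z} := by
    rintro x ⟨L, hL, hL'⟩ y ⟨L', hM, hM'⟩ s t hs ht hst
    refine ⟨s • L + t • L', fun g b hb => ?_, fun f => ?_⟩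
    · have h1 := mul_le_mul_of_nonneg_left (hL g b hb) hs
      have h2 := mul_le_mul_of_nonneg_left (hM g b hb) ht
      calc s * L g + t * L' g ≤ s * b + t * b := add_le_add h1 h2
        _ = b := by rw [← add_mul, hst, one_mul]
    · simp [hL', hM']
  refine convexHull_min (fun k hk => ?_) hconv hz
  refine ⟨{ toFun := fun g => g ⟨k, hk⟩, map_add' := fun _ _ => rfl, map_smul' := fun _ _ => rfl },
    fun g b hb => hb _, fun f => rfl⟩

/-- Representing functionals of nearby points of the convex hull are uniformly bounded on each `g`,
so they converge pointwise along an ultrafilter tending to `x`; the limit represents `x`. -/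
lemma exists_represents_of_mem_closure {K : Set E} [CompactSpace K] {x : E}
    (hx : x ∈ closure (convexHull ℝ K)) : ∃ L, Represents K L x := by
  have : ∀ z : E, ∃ L, z ∈ convexHull ℝ K → Represents K L z := fun z => by
    by_cases hz : z ∈ convexHull ℝ K
    · exact (exists_represents_of_mem_convexHull hz).imp fun L h _ => h
    · exact ⟨0, fun h => absurd h hz⟩
  choose L hL using this
  have := mem_closure_iff_nhdsWithin_neBot.1 hx
  let 𝒰 := Ultrafilter.of (𝓝[convexHull ℝ K] x)
  have hle : (𝒰 : Filter E) ≤ 𝓝[convexHull ℝ K] x := Ultrafilter.of_le _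
  have hmem : ∀ᶠ z in (𝒰 : Filter E), Represents K (L z) z :=
    mem_of_superset (hle self_mem_nhdsWithin) fun z hz => hL z hz
  have hlim : ∀ g : C_c(K, ℝ), ∃ y, Tendsto (fun z => L z g) 𝒰 (𝓝 y) := by
    intro g
    obtain ⟨B, hB⟩ := (isCompact_range g.continuous).isBounded.exists_norm_le
    have hg : ∀ k, ‖g k‖ ≤ B := fun k => hB _ (mem_range_self k)
    have h : ∀ᶠ z in (𝒰 : Filter E), L z g ∈ Icc (-B) B := by
      filter_upwards [hmem] with z hz
      have h1 := hz.1 g B fun k => (abs_le.1 (hg k)).2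
      have h2 := hz.1 (-g) B fun k => by
        have := (abs_le.1 (hg k)).1
        rw [CompactlySupportedContinuousMap.neg_apply]; linarith
      rw [map_neg] at h2
      exact ⟨by linarith, h1⟩
    obtain ⟨y, -, hy⟩ := (isCompact_Icc (a := -B) (b := B)).ultrafilter_le_nhds
      (𝒰.map fun z => L z g) (le_principal_iff.2 h)
    exact ⟨y, hy⟩
  choose Λ hΛ using hlim
  refine ⟨{ toFun := Λ, map_add' := fun g h => ?_, map_smul' := fun c g => ?_ },
    fun g b hb => ?_, fun f => ?_⟩
  · exact tendsto_nhds_unique (hΛ (g + h)) (by simpa using (hΛ g).add (hΛ h))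
  · exact tendsto_nhds_unique (hΛ (c • g)) (by simpa using (hΛ g).const_mul c)
  · exact le_of_tendsto (hΛ g) (hmem.mono fun z hz => hz.1 g b hb)
  · refine tendsto_nhds_unique (hΛ _) ?_
    have h : Tendsto f 𝒰 (𝓝 (f x)) := (f.continuous.tendsto x).mono_left
      (hle.trans nhdsWithin_le_nhds)
    exact h.congr' (hmem.mono fun z hz => (hz.2 f).symm)

/-- A point of the closed convex hull of a compact set is the barycenter of a probability
measure. -/
theorem exists_probabilityMeasure_barycenter [T2Space E] {K : Set E} [CompactSpace K]
    [MeasurableSpace K] [BorelSpace K] {x : E} (hx : x ∈ closure (convexHull ℝ K)) :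
    ∃ μ : Measure K, IsProbabilityMeasure μ ∧ ∀ f : StrongDual ℝ E, ∫ k, f k ∂μ = f x := by
  obtain ⟨L, hL, hLx⟩ := exists_represents_of_mem_closure hx
  let Λ : C_c(K, ℝ) →ₚ[ℝ] ℝ := PositiveLinearMap.mk₀ L fun g hg => by
    have := hL (-g) 0 fun k => by
      rw [CompactlySupportedContinuousMap.neg_apply]
      exact neg_nonpos.2 (hg k)
    rw [map_neg] at this
    linarith
  have hint : ∀ g : C_c(K, ℝ), ∫ k, g k ∂(RealRMK.rieszMeasure Λ) = L g := fun g =>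
    RealRMK.integral_rieszMeasure Λ g
  refine ⟨RealRMK.rieszMeasure Λ, ⟨?_⟩, fun f => (hint (restrictCompact K f)).trans (hLx f)⟩
  let one : C_c(K, ℝ) := ⟨1, HasCompactSupport.of_compactSpace _⟩
  have h1 := hint one
  have h2 : L one = 1 := by
    refine le_antisymm (hL one 1 fun k => le_rfl) ?_
    have := hL (-one) (-1) fun k => le_rfl
    rw [map_neg] at this
    linarith
  rw [h2] at h1
  have h3 : (RealRMK.rieszMeasure Λ).real univ = 1 := by
    simpa [one] using h1
  rw [measureReal_def] at h3
  exact (ENNReal.toReal_eq_one_iff _).1 h3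

/-- If a lower semicontinuous function is less than `1` on a compact set, then the functionals that
it dominates on this set are bounded away from `1` at each point of the closed convex hull. -/
theorem exists_lt_one_of_mem_closure_convexHull [T2Space E] {K : Set E} (hK : IsCompact K)
    {p : E → ℝ} (hp : LowerSemicontinuous p) (hp1 : ∀ k ∈ K, p k < 1) {x : E}
    (hx : x ∈ closure (convexHull ℝ K)) :
    ∃ c < 1, ∀ f : StrongDual ℝ E, (∀ k ∈ K, f k ≤ p k) → f x ≤ c := by
  have := isCompact_iff_compactSpace.1 hK
  let _ : MeasurableSpace K := borel K
  have : BorelSpace K := ⟨rfl⟩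
  obtain ⟨μ, hμ, hbar⟩ := exists_probabilityMeasure_barycenter hx
  -- As `p < 1` on `K`, these sets cover `K`, and one of them has positive measure.
  let A : ℕ → Set K := fun n => {k | p k ≤ 1 - 1 / ((n : ℝ) + 1)}
  have hAm : ∀ n, MeasurableSet (A n) := fun n =>
    ((hp.isClosed_preimage _).preimage continuous_subtype_val).measurableSet
  obtain ⟨n, hn⟩ : ∃ n, 0 < μ (A n) := by
    refine exists_measure_pos_of_not_measure_iUnion_null ?_
    have : ⋃ n, A n = univ := eq_univ_of_forall fun k => by
      obtain ⟨n, hn⟩ := exists_nat_one_div_lt (sub_pos.2 (hp1 k k.2))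
      exact mem_iUnion.2 ⟨n, by simp only [A, mem_ofPred_eq]; linarith⟩
    rw [this, measure_univ]
    exact one_ne_zero
  have hn' : 0 < μ.real (A n) := ENNReal.toReal_pos hn.ne' (measure_ne_top _ _)
  -- A dominated functional is at most `1 - 1/(n+1)` on `A n` and at most `1` elsewhere; integration
  -- gives this constant, independent of `f`.
  refine ⟨1 - μ.real (A n) * (1 / ((n : ℝ) + 1)), by
    have : 0 < μ.real (A n) * (1 / ((n : ℝ) + 1)) := by positivity
    linarith, fun f hf => ?_⟩
  have hfc : Continuous fun k : K => f k := f.continuous.comp continuous_subtype_val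
  have hint : Integrable (fun k : K => f k) μ :=
    hfc.integrable_of_hasCompactSupport (HasCompactSupport.of_compactSpace _)
  have hind : Integrable ((A n).indicator fun _ => 1 / ((n : ℝ) + 1)) μ :=
    (integrable_const _).indicator (hAm n)
  calc f x = ∫ k, f k ∂μ := (hbar f).symm
    _ ≤ ∫ k, (1 - (A n).indicator (fun _ => 1 / ((n : ℝ) + 1)) k) ∂μ := by
        refine integral_mono hint ((integrable_const _).sub hind) fun k => ?_
        by_cases hk : k ∈ A n
        · simp only [indicator_of_mem hk]
          exact (hf k k.2).trans hk
        · simp only [indicator_of_notMem hk, sub_zero]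
          exact (hf k k.2).trans (hp1 k k.2).le
    _ = 1 - μ.real (A n) * (1 / ((n : ℝ) + 1)) := by
        rw [integral_sub (integrable_const _) hind, integral_indicator_const _ (hAm n)]
        simp

end Barycenter

/-! ### Iterated slice derivation of a compact ball. -/

section Derivation

variable {E : Type*}

/-- The derivation that removes from `C` all slices, by functions in `Φ`, that belong to `𝒢`. -/
def sliceDerivation (Φ : Set (E → ℝ)) (𝒢 : Set (Set E)) (C : Set E) : Set E :=
  {y | y ∈ C ∧ ∀ φ ∈ Φ, ∀ a : ℝ, {z | z ∈ C ∧ a < φ z} ∈ 𝒢 → φ y ≤ a}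

lemma sliceDerivation_subset (Φ : Set (E → ℝ)) (𝒢 : Set (Set E)) (C : Set E) :
    sliceDerivation Φ 𝒢 C ⊆ C := fun _ h => h.1

lemma iterate_sliceDerivation_antitone (Φ : Set (E → ℝ)) (𝒢 : Set (Set E)) (B : Set E) :
    Antitone fun k => (sliceDerivation Φ 𝒢)^[k] B :=
  antitone_nat_of_succ_le fun k => by
    rw [Function.iterate_succ_apply']
    exact sliceDerivation_subset _ _ _

variable [AddCommGroup E] [Module ℝ E]

/-- Removing open slices means intersecting with the complementary closed half-spaces. -/
lemma convex_sliceDerivation {Φ : Set (E → ℝ)} (hΦ : ∀ φ ∈ Φ, IsLinearMap ℝ φ)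
    (𝒢 : Set (Set E)) {C : Set E} (hC : Convex ℝ C) : Convex ℝ (sliceDerivation Φ 𝒢 C) := by
  have h : sliceDerivation Φ 𝒢 C =
      C ∩ ⋂ φ ∈ Φ, ⋂ a : ℝ, ⋂ _ : {z | z ∈ C ∧ a < φ z} ∈ 𝒢, {y | φ y ≤ a} := by
    ext y; simp [sliceDerivation]
  rw [h]
  exact hC.inter (convex_iInter₂ fun φ hφ => convex_iInter₂ fun a _ =>
    convex_halfSpace_le (hΦ φ hφ) a)

lemma convex_iterate_sliceDerivation {Φ : Set (E → ℝ)} (hΦ : ∀ φ ∈ Φ, IsLinearMap ℝ φ)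
    (𝒢 : Set (Set E)) {B : Set E} (hB : Convex ℝ B) (k : ℕ) :
    Convex ℝ ((sliceDerivation Φ 𝒢)^[k] B) := by
  induction k with
  | zero => exact hB
  | succ k ih =>
    rw [Function.iterate_succ_apply']
    exact convex_sliceDerivation hΦ 𝒢 ih

variable [TopologicalSpace E]

omit [AddCommGroup E] [Module ℝ E] in
lemma isClosed_iterate_sliceDerivation {Φ : Set (E → ℝ)} (hΦ : ∀ φ ∈ Φ, Continuous φ)
    (𝒢 : Set (Set E)) {B : Set E} (hB : IsClosed B) (k : ℕ) :
    IsClosed ((sliceDerivation Φ 𝒢)^[k] B) := by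
  induction k with
  | zero => exact hB
  | succ k ih =>
    rw [Function.iterate_succ_apply']
    set C := (sliceDerivation Φ 𝒢)^[k] B
    have h : sliceDerivation Φ 𝒢 C =
        C ∩ ⋂ φ ∈ Φ, ⋂ a : ℝ, ⋂ _ : {z | z ∈ C ∧ a < φ z} ∈ 𝒢, {y | φ y ≤ a} := by
      ext y; simp [sliceDerivation]
    rw [h]
    exact ih.inter (isClosed_biInter fun φ hφ => isClosed_iInter fun a => isClosed_iInter fun _ =>
      isClosed_le (hΦ φ hφ) continuous_const)

/-- If the points of the unit sphere have neighbourhoods in `𝒢`, then the iterated derivation of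
the compact unit ball exhausts the unit sphere after `ω` steps. -/
theorem exists_notMem_iterate_sliceDerivation [IsTopologicalAddGroup E] [ContinuousSMul ℝ E]
    [LocallyConvexSpace ℝ E] [T2Space E] {Φ : Set (E → ℝ)}
    (hΦ : ∀ φ ∈ Φ, ∃ f : StrongDual ℝ E, ⇑f = φ) (hΦ' : ∀ f : StrongDual ℝ E, ⇑f ∈ Φ)
    {p : Seminorm ℝ E} (hl : LowerSemicontinuous p) (hB : IsCompact {x | p x ≤ 1})
    (hp : ∀ x, ∀ c < p x, ∃ φ ∈ Φ, (∀ y, φ y ≤ p y) ∧ c < φ x)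
    {𝒢 : Set (Set E)} (h𝒢 : ∀ T ∈ 𝒢, ∀ T' ⊆ T, T' ∈ 𝒢)
    (hN : ∀ x, p x = 1 → ∃ N, IsOpen N ∧ x ∈ N ∧ N ∈ 𝒢) {x : E} (hx : p x = 1) :
    ∃ k, x ∉ (sliceDerivation Φ 𝒢)^[k] {x | p x ≤ 1} := by
  by_contra! hxC
  have hΦlin : ∀ φ ∈ Φ, IsLinearMap ℝ φ := fun φ hφ => by
    obtain ⟨f, rfl⟩ := hΦ φ hφ
    exact f.toLinearMap.isLinear
  have hΦcont : ∀ φ ∈ Φ, Continuous φ := fun φ hφ => by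
    obtain ⟨f, rfl⟩ := hΦ φ hφ
    exact f.continuous
  let C : ℕ → Set E := fun k => (sliceDerivation Φ 𝒢)^[k] {x | p x ≤ 1}
  have hanti : Antitone C := iterate_sliceDerivation_antitone Φ 𝒢 _
  have hCcl : ∀ k, IsClosed (C k) := isClosed_iterate_sliceDerivation hΦcont 𝒢 hB.isClosed
  have hCconv : ∀ k, Convex ℝ (C k) := convex_iterate_sliceDerivation hΦlin 𝒢
    (by simpa using p.convexOn.convex_le 1)
  have hCB : ∀ k, C k ⊆ {x | p x ≤ 1} := fun k => hanti (Nat.zero_le k)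
  have hCω : IsCompact (⋂ k, C k) :=
    hB.of_isClosed_subset (isClosed_iInter hCcl) ((iInter_subset C 0).trans (hCB 0))
  have hCωconv : Convex ℝ (⋂ k, C k) := convex_iInter hCconv
  let O : Set E := ⋃₀ {N | IsOpen N ∧ N ∈ 𝒢}
  have hO : IsOpen O := isOpen_sUnion fun N h => h.1
  -- Otherwise all extreme points lie in the compact set `(⋂ k, C k) \ O`, where `p < 1` since `O`
  -- contains the sphere. By Krein–Milman `x` is in its closed convex hull, so the functionals
  -- dominated by `p` stay away from `1` at `x`, against `p x = 1`.
  obtain ⟨e, he, heO⟩ : ∃ e ∈ (⋂ k, C k).extremePoints ℝ, e ∈ O := by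
    by_contra! hext
    have hK : IsCompact ((⋂ k, C k) \ O) := hCω.diff hO
    have hsub : (⋂ k, C k).extremePoints ℝ ⊆ (⋂ k, C k) \ O :=
      fun e he => ⟨extremePoints_subset he, hext e he⟩
    have hxK : x ∈ closure (convexHull ℝ ((⋂ k, C k) \ O)) := by
      have hx' : x ∈ ⋂ k, C k := mem_iInter.2 hxC
      rw [← closure_convexHull_extremePoints hCω hCωconv] at hx'
      exact closure_mono (convexHull_mono hsub) hx'
    obtain ⟨c, hc, hcf⟩ := exists_lt_one_of_mem_closure_convexHull hK hl (fun k hk =>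
      lt_of_le_of_ne (hCB 0 (mem_iInter.1 hk.1 0)) fun h1 => hk.2 (by
        obtain ⟨N, hN, hkN, hN𝒢⟩ := hN k h1
        exact ⟨N, ⟨hN, hN𝒢⟩, hkN⟩)) hxK
    obtain ⟨φ, hφ, hφp, hcφ⟩ := hp x c (by rw [hx]; exact hc)
    obtain ⟨f, rfl⟩ := hΦ φ hφ
    exact not_lt_of_ge (hcf f fun k _ => hφp k) hcφ
  obtain ⟨N, ⟨hNo, hN𝒢⟩, heN⟩ := heO
  obtain ⟨f, a, hae, hfN⟩ := exists_slice_subset_of_mem_extremePoints hCω hCωconv he hNo heN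
  -- The closed slice of the intersection lies in `N`; by compactness this already holds for some `C
  -- k`, so the next derivation removes `e`.
  obtain ⟨k, hk⟩ : ∃ k, ¬ (C k ∩ {y | a ≤ f y} ∩ Nᶜ).Nonempty := by
    by_contra! hne
    have hcl : ∀ k, IsClosed (C k ∩ {y | a ≤ f y} ∩ Nᶜ) := fun k =>
      ((hCcl k).inter (isClosed_le continuous_const f.continuous)).inter hNo.isClosed_compl
    obtain ⟨y, hy⟩ := IsCompact.nonempty_iInter_of_sequence_nonempty_isCompact_isClosed
      (fun k => C k ∩ {y | a ≤ f y} ∩ Nᶜ)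
      (fun k => inter_subset_inter_left _ (inter_subset_inter_left _ (hanti (Nat.le_succ k))))
      hne (hB.of_isClosed_subset (hcl 0) fun y hy => hCB 0 hy.1.1) hcl
    rw [mem_iInter] at hy
    exact (hy 0).2 (hfN y (mem_iInter.2 fun k => (hy k).1.1) (hy 0).1.2)
  have hek : e ∈ C (k + 1) := mem_iInter.1 (extremePoints_subset he) (k + 1)
  simp only [C, Function.iterate_succ_apply'] at hek
  refine not_lt_of_ge (hek.2 f (hΦ' f) a (h𝒢 N hN𝒢 _ ?_)) hae
  rintro y ⟨hyC, hay⟩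
  by_contra hyN
  exact hk ⟨y, ⟨hyC, le_of_lt hay⟩, hyN⟩

end Derivation

/-! ### Moore spheres of norms with compact unit ball. -/

section CompactBall

variable {X : Type*} [NormedAddCommGroup X] [NormedSpace ℝ X]
  {F : Submodule ℝ (StrongDual ℝ X)} {p : Seminorm ℝ X}

/-- The sets whose `p`-neighbourhood of radius `1 / (m + 1)` meets the unit sphere of `p` within a
member of `G`. -/
def uniformlySmall (p : Seminorm ℝ X) (G : Set (Set (unitSphere p))) (m : ℕ) : Set (Set X) :=
  {T | ∃ U ∈ G, ∀ y ∈ T, ∀ z : unitSphere p, p (z - y) < 1 / ((m : ℝ) + 1) → z ∈ U}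

/-- Continuity of addition at `(x, 0)` gives neighbourhoods with `N + W ⊆ V`, where `V` cuts out a
member of the cover. Since `σ(X, F)` is coarser than the norm topology, `W` contains a norm ball,
which provides the uniform margin. -/
lemma exists_isOpen_mem_uniformlySmall (hp : IsEquivalentNorm p) {G : Set (Set (unitSphere p))}
    (hGo : ∀ U ∈ G, IsOpen[@instTopologicalSpaceSubtype X (fun x => x ∈ unitSphere p)
      (sigma (F : Set (StrongDual ℝ X)))] U) (hG : ⋃₀ G = univ) {x : X} (hx : p x = 1) :
    ∃ N, IsOpen[sigma (F : Set (StrongDual ℝ X))] N ∧ x ∈ N ∧ ∃ m, N ∈ uniformlySmall p G m := by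
  have hxG : (⟨x, hx⟩ : unitSphere p) ∈ ⋃₀ G := by rw [hG]; trivial
  obtain ⟨U, hU, hxU⟩ := hxG
  obtain ⟨V, hV, hVU⟩ := (@isOpen_induced_iff _ _ (sigma (F : Set (StrongDual ℝ X))) _ _).1 (hGo U hU)
  have hxV : x ∈ V := by rw [← hVU] at hxU; exact hxU
  obtain ⟨N, W, hN, hxN, hW, h0W, hNW⟩ : ∃ N W : Set X,
      IsOpen[sigma (F : Set (StrongDual ℝ X))] N ∧ x ∈ N ∧
      IsOpen[sigma (F : Set (StrongDual ℝ X))] W ∧ (0 : X) ∈ W ∧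
      ∀ y ∈ N, ∀ w ∈ W, y + w ∈ V := by
    have h1 := isTopologicalAddGroup_sigma (F : Set (StrongDual ℝ X))
    let _ : TopologicalSpace X := sigma (F : Set (StrongDual ℝ X))
    have hopen : IsOpen ((fun z : X × X => z.1 + z.2) ⁻¹' V) := hV.preimage continuous_add
    obtain ⟨N, W, hN, hW, hxN, h0W, h⟩ := isOpen_prod_iff.1 hopen x 0 (by simpa using hxV)
    exact ⟨N, W, hN, hxN, hW, h0W, fun y hy w hw => h (mk_mem_prod hy hw)⟩
  obtain ⟨r, hr, hrW⟩ := Metric.isOpen_iff.1 (norm_le_sigma _ W hW) 0 h0W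
  obtain ⟨c, _, hc, -, hcp⟩ := hp
  obtain ⟨m, hm⟩ := exists_nat_one_div_lt (mul_pos hc hr)
  refine ⟨N, hN, hxN, m, U, hU, fun y hy z hz => ?_⟩
  have hzW : (z : X) - y ∈ W := by
    refine hrW ?_
    rw [mem_ball_zero_iff]
    have := (hcp (z - y)).1
    exact lt_of_mul_lt_mul_left (by linarith) hc.le
  rw [← hVU]
  have := hNW y hy _ hzW
  rw [add_sub_cancel] at this
  exact this

/-- A point that almost satisfies all normalized linear inequalities valid on a `σ(X, F)`-compact
convex set `C` is close to `C`. -/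
lemma exists_mem_seminorm_sub_le (hp : IsEquivalentNorm p)
    (hl : IsLsc (sigma (F : Set (StrongDual ℝ X))) p)
    (hB : @IsCompact X (sigma (F : Set (StrongDual ℝ X))) {x | p x ≤ 1}) {C : Set X}
    (hC : @IsCompact X (sigma (F : Set (StrongDual ℝ X))) C) (hconv : Convex ℝ C) (hne : C.Nonempty)
    (hCB : C ⊆ {x | p x ≤ 1}) {v : X} {δ : ℝ} (hδ : 0 < δ)
    (h : ∀ f ∈ F, ∀ a : ℝ, (∀ y, |f y| ≤ p y) → |a| ≤ 1 → (∀ y ∈ C, f y ≤ a) → f v ≤ a + δ) :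
    ∃ y ∈ C, p (v - y) ≤ δ := by
  -- `D` is `C` plus `δ` times the unit ball, a compact convex set. A point outside it would be
  -- separated by a functional that, once normalized, violates the hypothesis.
  let D : Set X := (fun z : X × X => z.1 + δ • z.2) '' (C ×ˢ {x | p x ≤ 1})
  have hDconv : Convex ℝ D := by
    have := (hconv.prod (Seminorm.convex_le p 1)).is_linear_image
      (f := fun z : X × X => z.1 + δ • z.2)
      ⟨fun x y => by simp only [Prod.fst_add, Prod.snd_add, smul_add]; abel,
       fun c x => by simp only [Prod.smul_fst, Prod.smul_snd, smul_add, smul_comm δ c]⟩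
    exact this
  have hDcl : IsClosed[sigma (F : Set (StrongDual ℝ X))] D := by
    have h1 := isTopologicalAddGroup_sigma (F : Set (StrongDual ℝ X))
    have h2 := continuousSMul_sigma (F : Set (StrongDual ℝ X))
    have h3 := t3Space_sigma_subtype hp hl univ
    let _ : TopologicalSpace X := sigma (F : Set (StrongDual ℝ X))
    have : T2Space X := (Homeomorph.Set.univ X).symm.isEmbedding.t2Space
    exact ((hC.prod hB).image (by fun_prop)).isClosed
  have hvD : v ∈ D := by
    by_contra hv
    obtain ⟨f, hf, s, hfs, hsv⟩ := exists_sep_of_isClosed_sigma F hDconv hDcl hv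
    obtain ⟨c₀, hc₀, hmax⟩ : ∃ c₀ ∈ C, ∀ y ∈ C, f y ≤ f c₀ := by
      have hfc := continuous_sigma (F := (F : Set (StrongDual ℝ X))) hf
      let _ : TopologicalSpace X := sigma (F : Set (StrongDual ℝ X))
      exact hC.exists_isMaxOn hne hfc.continuousOn
    have hb : ∀ b, p b ≤ 1 → δ * f b < s - f c₀ := fun b hb => by
      have := hfs _ ⟨(c₀, b), ⟨hc₀, hb⟩, rfl⟩
      simp only [map_add, map_smul, smul_eq_mul] at this
      linarith
    -- On the unit ball `f` is at most `t / δ`, so `(δ / t) • f` is dominated by `p`; its separating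
    -- level is exactly `δ` above its maximum on `C`.
    obtain ⟨t, ht⟩ : ∃ t, t = s - f c₀ := ⟨_, rfl⟩
    have ht0 : 0 < t := by
      have := hb 0 (by simp)
      rw [map_zero, mul_zero] at this
      linarith
    have hbound : ∀ y, |((δ / t) • f) y| ≤ p y := fun y => by
      have h1 := mul_abs_le_of_le_on_ball (f := f) (r := 1) (c := t / δ)
        (fun x => hp.eq_zero) one_pos (fun y hy => by
          rw [le_div_iff₀ hδ]; linarith [hb y hy]) y
      rw [smul_apply, smul_eq_mul, abs_mul, abs_of_pos (div_pos hδ ht0)]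
      rw [one_mul] at h1
      calc δ / t * |f y| ≤ δ / t * (t / δ * p y) := by gcongr
        _ = p y := by field_simp
    have key := h ((δ / t) • f) (F.smul_mem _ hf) (δ / t * f c₀) hbound
      ((hbound c₀).trans (hCB hc₀)) (fun y hy => by
        rw [smul_apply, smul_eq_mul]
        have := hmax y hy
        gcongr)
    rw [smul_apply, smul_eq_mul] at key
    have h1 : δ / t * s < δ / t * f v := by gcongr
    have h2 : δ / t * s = δ / t * f c₀ + δ := by
      rw [show s = f c₀ + t by linarith]; field_simp
    linarith
  obtain ⟨⟨y, b⟩, ⟨hy, hb⟩, rfl⟩ := hvD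
  refine ⟨y, hy, ?_⟩
  simp only [add_sub_cancel_left, map_smul_eq_mul, Real.norm_of_nonneg hδ.le]
  have hb' : p b ≤ 1 := hb
  nlinarith

/-- If the unit ball of `p` is `σ(X, F)`-compact and its unit sphere is a Moore space, then there is
an equivalent `σ(X, F)`-LUR norm. -/
theorem exists_isLUR_of_isMooreSubset (hp : IsEquivalentNorm p)
    (hl : IsLsc (sigma (F : Set (StrongDual ℝ X))) p)
    (hB : @IsCompact X (sigma (F : Set (StrongDual ℝ X))) {x | p x ≤ 1})
    (hS : IsMooreSubset (sigma (F : Set (StrongDual ℝ X))) (unitSphere p)) :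
    ∃ q : Seminorm ℝ X, IsEquivalentNorm q ∧ IsLsc (sigma (F : Set (StrongDual ℝ X))) q ∧
      IsLUR (sigma (F : Set (StrongDual ℝ X))) q := by
  obtain ⟨-, G, hG⟩ := hS
  let Φ : Set (X → ℝ) := {φ | ∃ f ∈ F, ⇑f = φ}
  let 𝒢 : ℕ → Set (Set X) := fun n => {T | ∃ m, T ∈ uniformlySmall p (G n) m}
  let C : ℕ → ℕ → Set X := fun n k => (sliceDerivation Φ (𝒢 n))^[k] {x | p x ≤ 1}
  have hCB : ∀ n k, C n k ⊆ {x | p x ≤ 1} := fun n k =>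
    iterate_sliceDerivation_antitone Φ (𝒢 n) _ (Nat.zero_le k)
  have hCconv : ∀ n k, Convex ℝ (C n k) := fun n => convex_iterate_sliceDerivation
    (by rintro _ ⟨f, -, rfl⟩; exact f.toLinearMap.isLinear) (𝒢 n) (Seminorm.convex_le p 1)
  have hCcomp : ∀ n k, @IsCompact X (sigma (F : Set (StrongDual ℝ X))) (C n k) := fun n k => by
    have hΦc : ∀ φ ∈ Φ, @Continuous X ℝ (sigma (F : Set (StrongDual ℝ X))) _ φ := by
      rintro _ ⟨f, hf, rfl⟩
      exact continuous_sigma (F := (F : Set (StrongDual ℝ X))) hf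
    have hBcl := hl.isClosed_le 1
    let _ : TopologicalSpace X := sigma (F : Set (StrongDual ℝ X))
    exact hB.of_isClosed_subset (isClosed_iterate_sliceDerivation hΦc (𝒢 n) hBcl k) (hCB n k)
  have hexh : ∀ n x, p x = 1 → ∃ k, x ∉ C n k := by
    intro n x hx
    have h1 := isTopologicalAddGroup_sigma (F : Set (StrongDual ℝ X))
    have h2 := continuousSMul_sigma (F : Set (StrongDual ℝ X))
    have h3 := t3Space_sigma_subtype hp hl univ
    have h4 := locallyConvexSpace_sigma (F : Set (StrongDual ℝ X))
    have h5 := exists_mem_eq_of_continuous_sigma F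
    have h6 : ∀ f ∈ F, @Continuous X ℝ (sigma (F : Set (StrongDual ℝ X))) _ f := fun f hf =>
      continuous_sigma (F := (F : Set (StrongDual ℝ X))) hf
    have hsup : ∀ x, ∀ c < p x, ∃ φ ∈ Φ, (∀ y, φ y ≤ p y) ∧ c < φ x := fun x c hc => by
      obtain ⟨f, hf, hfp, hcf⟩ := exists_functional_of_lt hp hl hc
      exact ⟨f, ⟨f, hf, rfl⟩, fun y => (le_abs_self _).trans (hfp y), hcf⟩
    have hnbhd : ∀ x, p x = 1 → ∃ N, IsOpen[sigma (F : Set (StrongDual ℝ X))] N ∧ x ∈ N ∧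
        N ∈ 𝒢 n := fun x hx =>
      exists_isOpen_mem_uniformlySmall hp (hG.1 n).1 (hG.1 n).2 hx
    have hmono : ∀ T ∈ 𝒢 n, ∀ T' ⊆ T, T' ∈ 𝒢 n := by
      rintro T ⟨m, U, hU, h⟩ T' hT'
      exact ⟨m, U, hU, fun y hy => h y (hT' hy)⟩
    have hΦ1 : ∀ φ ∈ Φ, ∃ g : X →ₗ[ℝ] ℝ,
        @Continuous X ℝ (sigma (F : Set (StrongDual ℝ X))) _ g ∧ ⇑g = φ := by
      rintro _ ⟨f, hf, rfl⟩
      exact ⟨f.toLinearMap, h6 f hf, rfl⟩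
    have hΦ2 : ∀ g : X →ₗ[ℝ] ℝ, @Continuous X ℝ (sigma (F : Set (StrongDual ℝ X))) _ g →
        ⇑g ∈ Φ := fun g hg => by
      obtain ⟨f, hf, hfg⟩ := h5 g hg
      exact ⟨f, hf, funext hfg⟩
    clear_value Φ
    let _ : TopologicalSpace X := sigma (F : Set (StrongDual ℝ X))
    have : T2Space X := (Homeomorph.Set.univ X).symm.isEmbedding.t2Space
    refine exists_notMem_iterate_sliceDerivation (fun φ hφ => ?_)
      (fun f => hΦ2 f.toLinearMap f.continuous) hl hB hsup hmono hnbhd hx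
    obtain ⟨g, hg, hgφ⟩ := hΦ1 φ hφ
    exact ⟨⟨g, hg⟩, hgφ⟩
  -- The first kind consists of the half-spaces cutting small slices from `C n k`, sorted by margin
  -- `m` and bound `M`. The second consists of the normalized half-spaces that miss `C n k`; they
  -- serve to push `u n` towards `C n k`.
  let H : (ℕ × ℕ × ℕ × ℕ) ⊕ (ℕ × ℕ) → Set (StrongDual ℝ X × ℝ) := Sum.elim
    (fun i => {h | h.1 ∈ F ∧ (∀ x, |h.1 x| ≤ (i.2.2.2 : ℝ) * p x) ∧ |h.2| ≤ (i.2.2.2 : ℝ) ∧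
      {z | z ∈ C i.1 i.2.1 ∧ h.2 < h.1 z} ∈ uniformlySmall p (G i.1) i.2.2.1})
    (fun i => {h | h.1 ∈ F ∧ (∀ x, |h.1 x| ≤ p x) ∧ |h.2| ≤ 1 ∧ ∀ y ∈ C i.1 i.2, h.1 y ≤ h.2})
  obtain ⟨q, hq, hql, hloc⟩ := exists_slice_localizing_norm hp hl (H := H)
    (M := Sum.elim (fun i => (i.2.2.2 : ℝ)) fun _ => 1)
    (by rintro (i | i) <;> simp)
    (by
      rintro (i | i) h hh
      · exact ⟨hh.1, hh.2.1, hh.2.2.1⟩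
      · exact ⟨hh.1, by simpa using hh.2.1, hh.2.2.1⟩)
  refine ⟨q, hq, hql, isLUR_of_mem_starOf hp hq hG fun x u hx hu => ?_⟩
  obtain ⟨hpu, h⟩ := hloc x u hx hu
  refine ⟨hpu, fun n => ?_⟩
  obtain ⟨k, hk, hk'⟩ : ∃ k, x ∈ C n k ∧ x ∉ C n (k + 1) := by
    by_contra! hall
    obtain ⟨k, hk⟩ := hexh n x hx
    exact hk (Nat.rec (motive := fun k => x ∈ C n k) hx.le hall k)
  obtain ⟨f, hf, a, ⟨m, hm⟩, hax⟩ : ∃ f ∈ F, ∃ a : ℝ, {z | z ∈ C n k ∧ a < f z} ∈ 𝒢 n ∧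
      a < f x := by
    by_contra! hall
    refine hk' ?_
    simp only [C, Function.iterate_succ_apply']
    refine ⟨hk, ?_⟩
    rintro _ ⟨f, hf, rfl⟩ a ha
    exact hall f hf a ha
  obtain ⟨M, hM, hM'⟩ := hp.exists_nat_bound f a
  obtain ⟨η, hη, hev⟩ := (h (Sum.inl (n, k, m, M))).1 ⟨f, a, ⟨hf, hM, hM', hm⟩, hax⟩
  -- The distance `δ` to `C n k` has to be below the margin of the slice, and moving by `δ` must
  -- change a functional bounded by `M` by less than `η`.
  obtain ⟨δ, hδ, hδm, hδM⟩ : ∃ δ > 0, δ < 1 / ((m : ℝ) + 1) ∧ M * δ < η := by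
    have hM0 : (0 : ℝ) < M + 1 := by positivity
    obtain ⟨δ, hδ, h'⟩ := exists_between
      (lt_min (by positivity : (0 : ℝ) < 1 / ((m : ℝ) + 1)) (div_pos hη hM0))
    obtain ⟨h1, h2⟩ := lt_min_iff.1 h'
    rw [lt_div_iff₀ hM0] at h2
    exact ⟨δ, hδ, h1, by linarith⟩
  have hev' := (h (Sum.inr (n, k))).2 (fun f a hfa => hfa.2.2.2 x hk) δ hδ
  filter_upwards [hev, hev', hpu.eventually (lt_mem_nhds one_pos)]
    with j ⟨g, b, hg, hgx, hgu⟩ hclose hpos hv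
  obtain ⟨y, hy, hyv⟩ := exists_mem_seminorm_sub_le hp hl hB (hCcomp n k) (hCconv n k) ⟨x, hk⟩
    (hCB n k) (v := (p (u j))⁻¹ • u j) hδ fun f hf a h1 h2 h3 => by
      rw [map_smul, smul_eq_mul, inv_mul_le_iff₀ hpos, mul_comm]
      exact hclose f a ⟨hf, h1, h2, h3⟩
  obtain ⟨hgF, hgM, -, U, hU, hUg⟩ := hg
  -- Both `x` and the point `y` of `C n k` near the normalized `u j` lie in the small slice, so the
  -- margin puts `x` and the normalized `u j` into the same `U`.
  refine ⟨U, ⟨hU, hUg x ⟨hk, hgx⟩ ⟨x, hx⟩ ?_⟩, hUg y ⟨hy, ?_⟩ ⟨_, hv⟩ (hyv.trans_lt hδm)⟩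
  · rw [sub_self, map_zero]; positivity
  · have h1 : b + η < g ((p (u j))⁻¹ • u j) := by
      rw [map_smul, smul_eq_mul, lt_inv_mul_iff₀ hpos]
      linarith
    have h2 := (abs_le.1 (hgM ((p (u j))⁻¹ • u j - y))).2
    have h3 : (M : ℝ) * p ((p (u j))⁻¹ • u j - y) ≤ M * δ := by gcongr
    rw [map_sub] at h2
    show b < g y
    simp only at h2
    linarith

end CompactBall

/-! ### Weak* topology, dual norms and compactness of dual balls. -/

section DualNorms

variable {Y : Type*} [NormedAddCommGroup Y] [NormedSpace ℝ Y]

lemma weakStar_eq_sigma :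
    weakStar Y = sigma (canonicalImage Y : Set (StrongDual ℝ (StrongDual ℝ Y))) := by
  apply le_antisymm
  · refine le_iInf₂ fun f hf => ?_
    obtain ⟨y, rfl⟩ := hf
    exact (induced_mono (continuous_iff_le_induced.1 (WeakDual.eval_continuous y))).trans_eq
      induced_compose
  · have hc : ∀ y : Y, @Continuous (StrongDual ℝ Y) ℝ
        (sigma (canonicalImage Y : Set (StrongDual ℝ (StrongDual ℝ Y)))) _ fun f => f y := fun y =>
      continuous_sigma (F := (canonicalImage Y : Set (StrongDual ℝ (StrongDual ℝ Y))))
        (f := NormedSpace.inclusionInDoubleDual ℝ Y y) ⟨y, rfl⟩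
    generalize sigma (canonicalImage Y : Set (StrongDual ℝ (StrongDual ℝ Y))) = t at hc ⊢
    exact (@continuous_iff_le_induced _ _ (fun f : StrongDual ℝ Y => StrongDual.toWeakDual f) t _).1
      (@WeakDual.continuous_of_continuous_eval _ ℝ Y _ _ _ _ _ _ _ t
        (fun f : StrongDual ℝ Y => StrongDual.toWeakDual f) hc)

variable {p : Seminorm ℝ (StrongDual ℝ Y)}

/-- A dual norm is a supremum of absolute values of evaluations at points of `Y`, which are weak*
continuous. -/
lemma IsDualNorm.isLsc (hp : IsDualNorm p) :
    IsLsc (sigma (canonicalImage Y : Set (StrongDual ℝ (StrongDual ℝ Y)))) p := by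
  obtain ⟨q, -, hq⟩ := hp
  intro f a ha
  obtain ⟨_, ⟨y, hy, rfl⟩, hay⟩ := (lt_isLUB_iff (hq f)).1 ha
  have hc := continuous_sigma (F := (canonicalImage Y : Set (StrongDual ℝ (StrongDual ℝ Y))))
    (f := NormedSpace.inclusionInDoubleDual ℝ Y y) ⟨y, rfl⟩
  let _ : TopologicalSpace (StrongDual ℝ Y) :=
    sigma (canonicalImage Y : Set (StrongDual ℝ (StrongDual ℝ Y)))
  filter_upwards [hc.abs.continuousAt.eventually (lt_mem_nhds hay)] with g hg
  exact lt_of_lt_of_le hg ((hq g).1 ⟨y, hy, rfl⟩)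

/-- Banach–Alaoglu for the unit ball of an equivalent lower semicontinuous norm. -/
lemma isCompact_unitBall (hp : IsEquivalentNorm p)
    (hl : IsLsc (sigma (canonicalImage Y : Set (StrongDual ℝ (StrongDual ℝ Y)))) p) :
    @IsCompact (StrongDual ℝ Y) (sigma (canonicalImage Y : Set (StrongDual ℝ (StrongDual ℝ Y))))
      {f | p f ≤ 1} := by
  have hcl := hl.isClosed_le 1
  rw [← weakStar_eq_sigma] at hcl ⊢
  have hbd : Bornology.IsBounded {f : StrongDual ℝ Y | p f ≤ 1} := by
    obtain ⟨c, C, hc, -, h⟩ := hp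
    refine isBounded_iff_forall_norm_le.2 ⟨1 / c, fun f hf => ?_⟩
    rw [le_div_iff₀ hc, mul_comm]
    exact (h f).1.trans hf
  obtain ⟨s, hs, hsp⟩ := (@isClosed_induced_iff _ _ _ _ _).1 hcl
  refine (@IsInducing.isCompact_iff _ _ (weakStar Y) _ _
    (fun f : StrongDual ℝ Y => StrongDual.toWeakDual f)
    (@IsInducing.mk _ _ (weakStar Y) _ _ rfl)).2 ?_
  have himg : (fun f : StrongDual ℝ Y => StrongDual.toWeakDual f) '' {f | p f ≤ 1} = s := by
    rw [← hsp]
    exact image_preimage_eq s (StrongDual.toWeakDual (𝕜 := ℝ) (E := Y)).surjective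
  rw [himg]
  refine WeakDual.isCompact_of_bounded_of_closed ?_ hs
  rw [← WeakDual.isBounded_toWeakDual_preimage_iff_isBounded]
  exact hsp ▸ hbd

/-- An equivalent weak* lower semicontinuous norm on a dual space is a dual norm. -/
lemma isDualNorm_of_isLsc (hp : IsEquivalentNorm p)
    (hl : IsLsc (sigma (canonicalImage Y : Set (StrongDual ℝ (StrongDual ℝ Y)))) p) :
    IsDualNorm p := by
  obtain ⟨c, C, hc, hC, h⟩ := id hp
  have hle : ∀ (y : Y) (g : {g : StrongDual ℝ Y // p g ≤ 1}), |g.1 y| ≤ c⁻¹ * ‖y‖ := by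
    intro y g
    refine (g.1.le_opNorm y).trans ?_
    gcongr
    rw [← one_div, le_div_iff₀ hc, mul_comm]
    exact (h g.1).1.trans g.2
  have hbdd : ∀ y : Y, BddAbove (range fun g : {g : StrongDual ℝ Y // p g ≤ 1} => |g.1 y|) :=
    fun y => ⟨c⁻¹ * ‖y‖, by rintro _ ⟨g, rfl⟩; exact hle y g⟩
  have : Nonempty {g : StrongDual ℝ Y // p g ≤ 1} := ⟨⟨0, by simp⟩⟩
  -- The predual norm is the support function of the unit ball of `p`. That its dual norm is not
  -- smaller than `p` uses separation by evaluations at points of `Y`.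
  let q : Seminorm ℝ Y := Seminorm.of (fun y => ⨆ g : {g : StrongDual ℝ Y // p g ≤ 1}, |g.1 y|)
    (fun x y => ciSup_le fun g => by
      rw [map_add]
      exact (abs_add_le _ _).trans (add_le_add (le_ciSup (hbdd x) g) (le_ciSup (hbdd y) g)))
    (fun t y => by
      rw [Real.mul_iSup_of_nonneg (norm_nonneg t)]
      congr 1
      ext g
      rw [map_smul, smul_eq_mul, abs_mul, Real.norm_eq_abs])
  have hq : ∀ (y : Y) (g : StrongDual ℝ Y), p g ≤ 1 → |g y| ≤ q y := fun y g hg =>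
    le_ciSup (hbdd y) ⟨g, hg⟩
  refine ⟨q, ⟨C⁻¹, c⁻¹, inv_pos.2 hC, inv_pos.2 hc, fun y => ⟨?_, ciSup_le (hle y)⟩⟩,
    fun f => ⟨?_, fun b hb => ?_⟩⟩
  · obtain ⟨g, hg, hgy⟩ := exists_dual_vector'' ℝ y
    have h1 : p (C⁻¹ • g) ≤ 1 := by
      rw [map_smul_eq_mul, Real.norm_of_nonneg (inv_nonneg.2 hC.le), inv_mul_le_iff₀ hC]
      exact (h g).2.trans (by gcongr)
    have h2 := (le_abs_self _).trans (hq y _ h1)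
    rw [smul_apply, hgy] at h2
    exact h2
  · rintro _ ⟨y, hy, rfl⟩
    rcases eq_or_ne f 0 with rfl | hf
    · simp
    have hpf := hp.pos hf
    have h1 := (hq y _ (seminorm_inv_smul_self hpf).le).trans hy
    rw [smul_apply, smul_eq_mul, abs_mul, abs_of_pos (inv_pos.2 hpf),
      inv_mul_le_iff₀ hpf, mul_one] at h1
    exact h1
  · by_contra! hbf
    -- An evaluation dominated by `p` comes from a point of the unit ball of `q`.
    obtain ⟨_, ⟨y, rfl⟩, hy, hby⟩ := exists_functional_of_lt hp hl hbf
    have hqy : q y ≤ 1 := ciSup_le fun g => (hy g.1).trans g.2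
    exact not_lt_of_ge ((le_abs_self _).trans (hb ⟨y, hqy, rfl⟩)) hby

end DualNorms

end MooreRenorming

theorem mainTheorem1 :
    (∀ (X : Type*) [NormedAddCommGroup X] [NormedSpace ℝ X]
        (F : Submodule ℝ (StrongDual ℝ X)), MooreRenorming.IsNorming F →
      ((∃ p : Seminorm ℝ X, MooreRenorming.IsEquivalentNorm p ∧
          MooreRenorming.IsLsc (MooreRenorming.sigma (F : Set (StrongDual ℝ X))) p ∧
          MooreRenorming.IsLUR (MooreRenorming.sigma (F : Set (StrongDual ℝ X))) p) ↔
        ∃ p : Seminorm ℝ X, MooreRenorming.IsEquivalentNorm p ∧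
          MooreRenorming.IsLsc (MooreRenorming.sigma (F : Set (StrongDual ℝ X))) p ∧
          MooreRenorming.IsMooreSubsetWithSlices (F : Set (StrongDual ℝ X))
            (MooreRenorming.unitSphere p))) ∧
    (∀ (Y : Type*) [NormedAddCommGroup Y] [NormedSpace ℝ Y],
      (∃ p : Seminorm ℝ (StrongDual ℝ Y), MooreRenorming.IsEquivalentNorm p ∧
          MooreRenorming.IsLsc (MooreRenorming.sigma
            (MooreRenorming.canonicalImage Y : Set (StrongDual ℝ (StrongDual ℝ Y)))) p ∧
          MooreRenorming.IsLUR (MooreRenorming.sigma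
            (MooreRenorming.canonicalImage Y : Set (StrongDual ℝ (StrongDual ℝ Y)))) p) ↔
        ∃ p : Seminorm ℝ (StrongDual ℝ Y), MooreRenorming.IsEquivalentNorm p ∧
          MooreRenorming.IsDualNorm p ∧
          MooreRenorming.IsMooreSubset (MooreRenorming.weakStar Y)
            (MooreRenorming.unitSphere p)) := by
  refine ⟨fun X _ _ F _ => ⟨?_, ?_⟩, fun Y _ _ => ⟨?_, ?_⟩⟩
  · rintro ⟨p, hp, hl, hr⟩
    exact ⟨p, hp, hl, MooreRenorming.isMooreSubsetWithSlices_of_isLUR hp hl hr⟩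
  · rintro ⟨p, hp, hl, hS⟩
    exact MooreRenorming.exists_isLUR_of_isMooreSubsetWithSlices hp hl hS
  · rintro ⟨p, hp, hl, hr⟩
    obtain ⟨h3, G, hG, -⟩ := MooreRenorming.isMooreSubsetWithSlices_of_isLUR hp hl hr
    refine ⟨p, hp, MooreRenorming.isDualNorm_of_isLsc hp hl, ?_⟩
    rw [MooreRenorming.weakStar_eq_sigma]
    exact ⟨h3, G, hG⟩
  · rintro ⟨p, hp, hd, hS⟩
    rw [MooreRenorming.weakStar_eq_sigma] at hS
    exact MooreRenorming.exists_isLUR_of_isMooreSubset hp hd.isLsc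
      (MooreRenorming.isCompact_unitBall hp hd.isLsc) hS
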